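/- A \emph{combinatory algebra} is a structure $(C,\cdot,\mathsf k,\mathsf s)$ with a binary operation and two constants such that $\mathsf kxy=x$ and $\mathsf sxyz=xz(yz)$ for all $x,y,z\in C$. It is \emph{directly indecomposable} if it is not isomorphic to the Cartesian product of two combinatory algebras each having at least two elements. Consider the following three Cartesian closed categories. (1) Complete partial orders (with least element and least upper bounds of directed sets) and Scott continuous maps; function spaces are ordered pointwise. (2) dI-domains (bounded complete algebraic complete partial orders in which $x\wedge(y\vee z)=(x\wedge y)\vee(x\wedge z)$ whenever $y,z$ have an upper bound, and in which every compact element has only finitely many elements below it) and stable maps (Scott continuous maps that preserve the meet of every pair having an upper bound); function spaces carry the stable order: $f\le g$ iff $f(x)=f(y)\wedge g(x)$ for all $x\le y$. (3) dI-domains with coherence (dI-domains $E$ with a set $\mathcal C(E)$ of non-empty finite subsets that contains all singletons; contains every non-empty finite $B$ for which there is $A\in\mathcal C(E)$ such that each $b\in B$ is below some $a\in A$ and each $a\in A$ is above some $b\in B$; and contains $\{\bigvee D_1,\dots,\bigvee D_n\}$ whenever $D_1,\dots,D_n$ are directed and $\{x_1,\dots,x_n\}\in\mathcal C(E)$ for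 all $x_i\in D_i$) and strongly stable maps (Scott continuous maps that send coherent sets to coherent sets and preserve their meets). Function spaces $E\Rightarrow E'$ carry the stable order, and a non-empty finite $F$ is coherent iff for all $A\in\mathcal C(E)$ and all $M\subseteq F\times A$ projecting onto $F$ and onto $A$, the set $\{f(a):(f,a)\in M\}$ is coherent with meet $(\bigwedge F)(\bigwedge A)$. A continuous (respectively stable, strongly stable) model of the $\lambda$-calculus is a reflexive object of category (1) (respectively (2), (3)): an object $U$ with morphisms $\mathrm{App}:U\to[U\Rightarrow U]$ and $\mathrm{Abs}:[U\Rightarrow U]\to U$ such that $\mathrm{App}\circ\mathrm{Abs}=\mathrm{id}$. It is a combinatory algebra with $x\cdot y=\mathrm{App}(x)(y)$, $\mathsf k=\lambda xy.x$ and $\mathsf s=\lambda xyz.xz(yz)$, where $\lambda x.f(x)$ stands for $\mathrm{Abs}(f)$. A $\lambda$-theory is a congruence (for application and abstraction) on the set of $\lambda$-terms modulo $\alpha$-equivalence that contains $\beta$-conversion. A $\lambda$-term is solvable if it is $\beta$-convertible to a term $\lambda x_1\dots x_n.yM_1\cdots M_k$ with $n,k\ge 0$ and $y$ a variable (free or bound).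 A $\lambda$-theory is semi-sensible if it never equates a solvable and an unsolvable term. The term model of a $\lambda$-theory $\mathcal T$ is the set of (open) $\lambda$-terms modulo $\mathcal T$ with application, $\mathsf k=[\lambda xy.x]$ and $\mathsf s=[\lambda xyz.xz(yz)]$. Theorem. Every continuous, every stable and every strongly stable model of the $\lambda$-calculus is directly indecomposable as a combinatory algebra. The term model of every semi-sensible $\lambda$-theory is directly indecomposable as a combinatory algebra. -/

import Mathlib

open Set

universe u v w

/-! ## Combinatory algebras and direct indecomposability -/

/-- A combinatory algebra `(C, ·, k, s)`. -/
structure CombinatoryAlgebra : Type (u + 1) where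
  carrier : Type u
  app : carrier → carrier → carrier
  k : carrier
  s : carrier
  k_app : ∀ x y, app (app k x) y = x
  s_app : ∀ x y z, app (app (app s x) y) z = app (app x z) (app y z)

namespace CombinatoryAlgebra

/-- The Cartesian product of two combinatory algebras. -/
def prod (B : CombinatoryAlgebra.{u}) (C : CombinatoryAlgebra.{v}) :
    CombinatoryAlgebra.{max u v} where
  carrier := B.carrier × C.carrier
  app x y := (B.app x.1 y.1, C.app x.2 y.2)
  k := (B.k, C.k)
  s := (B.s, C.s)
  k_app x y := by simp [B.k_app, C.k_app]
  s_app x y z := by simp [B.s_app, C.s_app]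

/-- Isomorphisms of combinatory algebras. -/
structure Iso (A : CombinatoryAlgebra.{u}) (B : CombinatoryAlgebra.{v}) where
  toEquiv : A.carrier ≃ B.carrier
  map_app : ∀ x y, toEquiv (A.app x y) = B.app (toEquiv x) (toEquiv y)
  map_k : toEquiv A.k = B.k
  map_s : toEquiv A.s = B.s

/-- A combinatory algebra is directly indecomposable if it is not isomorphic to the Cartesian
product of two non-trivial combinatory algebras. (Factors of `A` are quotients of `A`, so nothing is
lost by taking them in the universe of `A`.) -/
def DirectlyIndecomposable (A : CombinatoryAlgebra.{u}) : Prop :=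
  ¬ ∃ B C : CombinatoryAlgebra.{u},
    Nontrivial B.carrier ∧ Nontrivial C.carrier ∧ Nonempty (Iso A (B.prod C))

end CombinatoryAlgebra

/-! ## The continuous semantics: complete partial orders and Scott continuous maps -/

/-- Scott continuous maps. -/
structure ScottMap (α : Type u) (β : Type v) [PartialOrder α] [PartialOrder β] where
  toFun : α → β
  scottContinuous : ScottContinuous toFun

namespace ScottMap

instance {α : Type u} {β : Type v} [PartialOrder α] [PartialOrder β] :
    FunLike (ScottMap α β) α β where
  coe := toFun
  coe_injective f g h := by cases f; cases g; congr

/-- The function space is ordered pointwise. -/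
instance {α : Type u} {β : Type v} [PartialOrder α] [PartialOrder β] :
    PartialOrder (ScottMap α β) where
  le f g := ∀ x, f x ≤ g x
  le_refl f x := le_rfl
  le_trans f g h h₁ h₂ x := (h₁ x).trans (h₂ x)
  le_antisymm f g h₁ h₂ := DFunLike.ext f g fun x => (h₁ x).antisymm (h₂ x)

theorem isLUB_apply {α : Type u} {β : Type v} [PartialOrder α] [CompletePartialOrder β]
    {F : Set (ScottMap α β)} (hF : DirectedOn (· ≤ ·) F) {f : ScottMap α β} (hf : IsLUB F f)
    (x : α) : IsLUB ((fun g : ScottMap α β => g x) '' F) (f x) := by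
  have hdir : ∀ x, DirectedOn (· ≤ ·) ((fun g : ScottMap α β => g x) '' F) := by
    rintro x _ ⟨g, hg, rfl⟩ _ ⟨h, hh, rfl⟩
    obtain ⟨l, hl, h₁, h₂⟩ := hF g hg h hh
    exact ⟨l x, ⟨l, hl, rfl⟩, h₁ x, h₂ x⟩
  have hlub := fun x => (hdir x).isLUB_sSup
  have hp : ScottContinuous fun x => sSup ((fun g : ScottMap α β => g x) '' F) := by
    intro d hd hd' a ha
    constructor
    · rintro _ ⟨z, hz, rfl⟩
      refine (hlub z).2 ?_
      rintro _ ⟨g, hg, rfl⟩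
      exact (g.scottContinuous.monotone (ha.1 hz)).trans ((hlub a).1 ⟨g, hg, rfl⟩)
    · intro b hb
      refine (hlub a).2 ?_
      rintro _ ⟨g, hg, rfl⟩
      refine (g.scottContinuous hd hd' ha).2 ?_
      rintro _ ⟨z, hz, rfl⟩
      exact ((hlub z).1 ⟨g, hg, rfl⟩).trans (hb ⟨z, hz, rfl⟩)
  have hp' : IsLUB F (⟨_, hp⟩ : ScottMap α β) :=
    ⟨fun g hg y => (hlub y).1 ⟨g, hg, rfl⟩, fun g hg y => (hlub y).2 (by
      rintro _ ⟨h, hh, rfl⟩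
      exact hg hh y)⟩
  rw [hf.unique hp']
  exact hlub x

/-- Currying. -/
def curry {γ : Type w} {α : Type u} {β : Type v} [PartialOrder γ] [PartialOrder α]
    [PartialOrder β] (h : ScottMap (γ × α) β) : ScottMap γ (ScottMap α β) where
  toFun z := ⟨fun x => h (z, x), fun d hd hd' a ha => by
    have := ((ScottContinuous.prodMk (ScottContinuous.const z) ScottContinuous.id).comp
      h.scottContinuous) hd hd' ha
    exact this⟩
  scottContinuous d hd hd' a ha := by
    have key : ∀ x, IsLUB ((fun z => h (z, x)) '' d) (h (a, x)) := fun x =>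
      ((ScottContinuous.prodMk ScottContinuous.id (ScottContinuous.const x)).comp
        h.scottContinuous) hd hd' ha
    constructor
    · rintro _ ⟨z, hz, rfl⟩ x
      exact (key x).1 ⟨z, hz, rfl⟩
    · intro g hg x
      refine (key x).2 ?_
      rintro _ ⟨z, hz, rfl⟩
      exact hg ⟨z, hz, rfl⟩ x

/-- Uncurrying. -/
def uncurry {γ : Type w} {α : Type u} {β : Type v} [PartialOrder γ] [PartialOrder α]
    [CompletePartialOrder β] (h : ScottMap γ (ScottMap α β)) : ScottMap (γ × α) β where
  toFun p := h p.1 p.2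
  scottContinuous := by
    refine ScottContinuous.fromProd (fun a => (h a).scottContinuous) ?_
    intro x d hd hd' a ha
    have := isLUB_apply (DirectedOn.mono_comp (fun _ _ hab => h.scottContinuous.monotone hab) hd')
      (h.scottContinuous hd hd' ha) x
    rw [image_image] at this
    exact this

/-- Composition. -/
def comp {γ : Type w} {α : Type u} {β : Type v} [PartialOrder γ] [PartialOrder α]
    [PartialOrder β] (g : ScottMap α β) (f : ScottMap γ α) : ScottMap γ β :=
  ⟨fun x => g (f x), f.scottContinuous.comp g.scottContinuous⟩

end ScottMap

/-- A continuous model: a reflexive object `(U, App, Abs)` in the category of complete partial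
orders and Scott continuous maps. -/
structure ContinuousModel : Type (u + 1) where
  U : Type u
  [cpo : CompletePartialOrder U]
  App : ScottMap U (ScottMap U U)
  Abs : ScottMap (ScottMap U U) U
  app_abs : ∀ f, App (Abs f) = f

namespace ContinuousModel

attribute [instance] cpo

variable (D : ContinuousModel.{u})

/-- The map `x ↦ λy.x`. -/
def kMap : ScottMap D.U D.U :=
  D.Abs.comp (ScottMap.curry ⟨Prod.fst, ScottContinuous.fst⟩)

/-- The map `((x, y), z) ↦ xz(yz)`. -/
def sMap₃ : ScottMap ((D.U × D.U) × D.U) D.U where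
  toFun p := D.App (D.App p.1.1 p.2) (D.App p.1.2 p.2)
  scottContinuous := by
    have h := (ScottMap.uncurry D.App).scottContinuous
    have h₁ : ScottContinuous fun p : (D.U × D.U) × D.U => p.1.1 :=
      ScottContinuous.fst.comp ScottContinuous.fst
    have h₂ : ScottContinuous fun p : (D.U × D.U) × D.U => p.1.2 :=
      ScottContinuous.fst.comp ScottContinuous.snd
    have h₃ : ScottContinuous fun p : (D.U × D.U) × D.U => p.2 := ScottContinuous.snd
    exact (((h₁.prodMk h₃).comp h).prodMk ((h₂.prodMk h₃).comp h)).comp h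

/-- The map `x ↦ λyz.xz(yz)`. -/
def sMap : ScottMap D.U D.U :=
  D.Abs.comp (ScottMap.curry (D.Abs.comp (ScottMap.curry D.sMap₃)))

/-- The combinatory algebra underlying the `λ`-model of the points of `U`:
`x · y = App(x)(y)`, `k = λxy.x` and `s = λxyz.xz(yz)`. -/
def toCombinatoryAlgebra : CombinatoryAlgebra.{u} where
  carrier := D.U
  app x y := D.App x y
  k := D.Abs D.kMap
  s := D.Abs D.sMap
  k_app x y := by
    rw [D.app_abs]
    change D.App (D.Abs _) y = x
    rw [D.app_abs]
    rfl
  s_app x y z := by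
    rw [D.app_abs]
    change D.App (D.App (D.Abs _) y) z = _
    rw [D.app_abs]
    change D.App (D.Abs _) z = _
    rw [D.app_abs]
    rfl

end ContinuousModel

/-! ## The stable semantics: dI-domains and stable maps -/

/-- A dI-domain: a bounded complete algebraic cpo, distributive, in which every compact element has
only finitely many elements below it. Binary meets exist by bounded completeness; they are
recorded as data. -/
class DIDomain (α : Type u) extends CompletePartialOrder α, SemilatticeInf α where
  exists_isLUB : ∀ s : Set α, BddAbove s → ∃ a, IsLUB s a
  directedOn_compact : ∀ x : α, DirectedOn (· ≤ ·) {c : α | IsCompactElement c ∧ c ≤ x}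
  isLUB_compact : ∀ x : α, IsLUB {c : α | IsCompactElement c ∧ c ≤ x} x
  inf_distrib : ∀ x y z j : α, IsLUB {y, z} j → IsLUB {x ⊓ y, x ⊓ z} (x ⊓ j)
  finite_below : ∀ c : α, IsCompactElement c → {x : α | x ≤ c}.Finite

theorem DIDomain.le_of_compact {α : Type u} [DIDomain α] {x y : α}
    (h : ∀ c : α, IsCompactElement c → c ≤ x → c ≤ y) : x ≤ y :=
  (DIDomain.isLUB_compact x).2 fun c hc => h c hc.1 hc.2

theorem exists_le_of_isLUB_image {ι : Type v} {α : Type u} [PartialOrder α] {s : Set ι}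
    {f : ι → α} {a c : α} (hc : IsCompactElement c) (hs : s.Nonempty)
    (hd : DirectedOn (· ≤ ·) (f '' s)) (ha : IsLUB (f '' s) a) (hca : c ≤ a) :
    ∃ i ∈ s, c ≤ f i := by
  obtain ⟨_, ⟨i, hi, rfl⟩, h⟩ := hc _ _ (hs.image f) hd ha hca
  exact ⟨i, hi, h⟩

/-- A map is stable if it is Scott continuous and preserves the meets of compatible pairs. -/
structure IsStable {α : Type u} {β : Type v} [PartialOrder α] [PartialOrder β] (f : α → β) :
    Prop where
  scottContinuous : ScottContinuous f
  map_isGLB : ∀ x y m, BddAbove {x, y} → IsGLB {x, y} m → IsGLB {f x, f y} (f m)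

/-- Stable maps. -/
structure StableMap (α : Type u) (β : Type v) [PartialOrder α] [PartialOrder β] where
  toFun : α → β
  isStable : IsStable toFun

namespace IsStable

variable {α : Type u} {β : Type v} {γ : Type w} [PartialOrder α] [PartialOrder β] [PartialOrder γ]

theorem monotone {f : α → β} (hf : IsStable f) : Monotone f := hf.scottContinuous.monotone

theorem comp {g : β → γ} {f : α → β} (hg : IsStable g) (hf : IsStable f) :
    IsStable fun x => g (f x) where
  scottContinuous := hf.scottContinuous.comp hg.scottContinuous
  map_isGLB x y m hb hm := by
    refine hg.map_isGLB _ _ _ ?_ (hf.map_isGLB x y m hb hm)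
    have := hf.monotone.map_bddAbove hb
    rwa [image_pair] at this

theorem fst : IsStable (Prod.fst : α × β → α) where
  scottContinuous := ScottContinuous.fst
  map_isGLB x y m _ hm := by
    have := (isGLB_prod.1 hm).1
    rwa [image_pair] at this

theorem snd : IsStable (Prod.snd : α × β → β) where
  scottContinuous := ScottContinuous.snd
  map_isGLB x y m _ hm := by
    have := (isGLB_prod.1 hm).2
    rwa [image_pair] at this

theorem prodMk {f : γ → α} {g : γ → β} (hf : IsStable f) (hg : IsStable g) :
    IsStable fun x => (f x, g x) where
  scottContinuous := hf.scottContinuous.prodMk hg.scottContinuous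
  map_isGLB x y m hb hm := by
    refine isGLB_prod.2 ⟨?_, ?_⟩
    · rw [image_pair]
      exact hf.map_isGLB x y m hb hm
    · rw [image_pair]
      exact hg.map_isGLB x y m hb hm

theorem const (a : β) : IsStable fun _ : α => a where
  scottContinuous := ScottContinuous.const a
  map_isGLB x y m _ _ := by simp

theorem id : IsStable fun x : α => x where
  scottContinuous := ScottContinuous.id
  map_isGLB _ _ _ _ hm := hm

end IsStable

namespace StableMap

instance {α : Type u} {β : Type v} [PartialOrder α] [PartialOrder β] :
    FunLike (StableMap α β) α β where
  coe := toFun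
  coe_injective f g h := by cases f; cases g; congr

/-- The function space carries the stable (Berry) order: `f ≤ g` if and only if
`f x = f y ⊓ g x` for all `x ≤ y`. -/
instance {α : Type u} {β : Type v} [PartialOrder α] [SemilatticeInf β] :
    PartialOrder (StableMap α β) where
  le f g := ∀ x y, x ≤ y → f x = f y ⊓ g x
  le_refl f x y h := (inf_eq_right.2 (f.isStable.monotone h)).symm
  le_trans f g h h₁ h₂ x y hxy := by
    have hfg : f y ≤ g y := (h₁ y y le_rfl).le.trans inf_le_right
    rw [h₁ x y hxy, h₂ x y hxy, ← inf_assoc, inf_eq_left.2 hfg]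
  le_antisymm f g h₁ h₂ := DFunLike.ext f g fun x => by
    rw [h₁ x x le_rfl, inf_comm, ← h₂ x x le_rfl]

theorem apply_le {α : Type u} {β : Type v} [PartialOrder α] [SemilatticeInf β]
    {f g : StableMap α β} (h : f ≤ g) (x : α) : f x ≤ g x :=
  inf_eq_left.1 (h x x le_rfl).symm

theorem isLUB_apply {α : Type u} {β : Type v} [PartialOrder α] [DIDomain β]
    {F : Set (StableMap α β)} (hne : F.Nonempty) (hF : DirectedOn (· ≤ ·) F)
    {f : StableMap α β} (hf : IsLUB F f) (x : α) :
    IsLUB ((fun g : StableMap α β => g x) '' F) (f x) := by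
  have hdir : ∀ x, DirectedOn (· ≤ ·) ((fun g : StableMap α β => g x) '' F) := fun x =>
    DirectedOn.mono_comp (fun _ _ h => apply_le h x) hF
  have hlub := fun x => (hdir x).isLUB_sSup
  have hcpt : ∀ x c, IsCompactElement c → c ≤ sSup ((fun g : StableMap α β => g x) '' F) →
      ∃ g ∈ F, c ≤ g x := fun x c hc h => exists_le_of_isLUB_image hc hne (hdir x) (hlub x) h
  have hmono : Monotone fun x => sSup ((fun g : StableMap α β => g x) '' F) := by
    intro y z hyz
    refine (hlub y).2 ?_
    rintro _ ⟨g, hg, rfl⟩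
    exact (g.isStable.monotone hyz).trans ((hlub z).1 ⟨g, hg, rfl⟩)
  have hp : IsStable fun x => sSup ((fun g : StableMap α β => g x) '' F) := by
    refine ⟨fun d hd hd' a ha => ⟨?_, fun b hb => ?_⟩, fun y z m hb hm => ⟨?_, fun b hb => ?_⟩⟩
    · rintro _ ⟨z, hz, rfl⟩
      exact hmono (ha.1 hz)
    · refine (hlub a).2 ?_
      rintro _ ⟨g, hg, rfl⟩
      refine (g.isStable.scottContinuous hd hd' ha).2 ?_
      rintro _ ⟨z, hz, rfl⟩
      exact ((hlub z).1 ⟨g, hg, rfl⟩).trans (hb ⟨z, hz, rfl⟩)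
    · rintro _ (rfl | rfl)
      · exact hmono (hm.1 (by simp))
      · exact hmono (hm.1 (by simp))
    · refine DIDomain.le_of_compact fun c hc hcb => ?_
      obtain ⟨g, hg, hcg⟩ := hcpt y c hc (hcb.trans (hb (by simp)))
      obtain ⟨h, hh, hch⟩ := hcpt z c hc (hcb.trans (hb (by simp)))
      obtain ⟨l, hl, hgl, hhl⟩ := hF g hg h hh
      refine le_trans ?_ ((hlub m).1 ⟨l, hl, rfl⟩)
      refine (l.isStable.map_isGLB y z m ‹_› hm).2 ?_
      rintro _ (rfl | rfl)
      · exact hcg.trans (apply_le hgl _)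
      · exact hch.trans (apply_le hhl _)
  have hp' : IsLUB F (⟨_, hp⟩ : StableMap α β) := by
    constructor
    · intro g hg y z hyz
      refine le_antisymm (le_inf (g.isStable.monotone hyz) ((hlub y).1 ⟨g, hg, rfl⟩)) ?_
      refine DIDomain.le_of_compact fun c hc hcb => ?_
      obtain ⟨h, hh, hch⟩ := hcpt y c hc (hcb.trans inf_le_right)
      obtain ⟨l, hl, hgl, hhl⟩ := hF g hg h hh
      rw [hgl y z hyz]
      exact le_inf (hcb.trans inf_le_left) (hch.trans (apply_le hhl _))
    · intro g hg y z hyz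
      refine le_antisymm (le_inf (hmono hyz) ((hlub y).2 ?_)) ?_
      · rintro _ ⟨h, hh, rfl⟩
        exact apply_le (hg hh) y
      · refine DIDomain.le_of_compact fun c hc hcb => ?_
        obtain ⟨h, hh, hch⟩ := hcpt z c hc (hcb.trans inf_le_left)
        refine le_trans ?_ ((hlub y).1 ⟨h, hh, rfl⟩)
        change c ≤ h y
        rw [hg hh y z hyz]
        exact le_inf hch (hcb.trans inf_le_right)
  rw [hf.unique hp']
  exact hlub x

theorem isGLB_apply {α : Type u} {β : Type v} [PartialOrder α] [DIDomain β]
    {f₁ f₂ f : StableMap α β} (hb : BddAbove {f₁, f₂}) (hf : IsGLB {f₁, f₂} f) (x : α) :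
    f x = f₁ x ⊓ f₂ x := by
  obtain ⟨g, hg⟩ := hb
  have hg₁ : f₁ ≤ g := hg (by simp)
  have hg₂ : f₂ ≤ g := hg (by simp)
  have hq : IsStable fun x => f₁ x ⊓ f₂ x := by
    have hmono : Monotone fun x => f₁ x ⊓ f₂ x := fun y z h =>
      inf_le_inf (f₁.isStable.monotone h) (f₂.isStable.monotone h)
    refine ⟨fun d hd hd' a ha => ⟨?_, fun b hb => ?_⟩, fun y z m hb hm => ?_⟩
    · rintro _ ⟨z, hz, rfl⟩
      exact hmono (ha.1 hz)
    · refine DIDomain.le_of_compact fun c hc hcb => ?_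
      obtain ⟨y, hy, hcy⟩ := exists_le_of_isLUB_image hc hd
        (DirectedOn.mono_comp (fun _ _ h => f₁.isStable.monotone h) hd')
        (f₁.isStable.scottContinuous hd hd' ha) (hcb.trans inf_le_left)
      obtain ⟨z, hz, hcz⟩ := exists_le_of_isLUB_image hc hd
        (DirectedOn.mono_comp (fun _ _ h => f₂.isStable.monotone h) hd')
        (f₂.isStable.scottContinuous hd hd' ha) (hcb.trans inf_le_right)
      obtain ⟨w, hw, hyw, hzw⟩ := hd' y hy z hz
      exact (le_inf (hcy.trans (f₁.isStable.monotone hyw))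
        (hcz.trans (f₂.isStable.monotone hzw))).trans (hb ⟨w, hw, rfl⟩)
    · have h₁ := (f₁.isStable.map_isGLB y z m hb hm).unique isGLB_pair
      have h₂ := (f₂.isStable.map_isGLB y z m hb hm).unique isGLB_pair
      change IsGLB _ (f₁.toFun m ⊓ f₂.toFun m)
      rw [h₁, h₂, inf_inf_inf_comm]
      exact isGLB_pair
  have key : ∀ {y z}, y ≤ z → f₁ y ⊓ f₂ y = (f₁ z ⊓ f₂ z) ⊓ f₁ y ∧
      f₁ y ⊓ f₂ y = (f₁ z ⊓ f₂ z) ⊓ f₂ y := by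
    intro y z hyz
    have hm := inf_le_inf (f₁.isStable.monotone hyz) (f₂.isStable.monotone hyz)
    constructor
    · refine le_antisymm (le_inf hm inf_le_left) (le_inf inf_le_right ?_)
      rw [hg₂ y z hyz]
      exact le_inf (inf_le_left.trans inf_le_right) (inf_le_right.trans (apply_le hg₁ y))
    · refine le_antisymm (le_inf hm inf_le_right) (le_inf ?_ inf_le_right)
      rw [hg₁ y z hyz]
      exact le_inf (inf_le_left.trans inf_le_left) (inf_le_right.trans (apply_le hg₂ y))
  have hq' : IsGLB {f₁, f₂} (⟨_, hq⟩ : StableMap α β) := by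
    constructor
    · rintro _ (rfl | rfl) y z hyz
      · exact (key hyz).1
      · exact (key hyz).2
    · intro r hr y z hyz
      have hr₁ := hr (show f₁ ∈ ({f₁, f₂} : Set _) by simp) y z hyz
      have hr₂ := hr (show f₂ ∈ ({f₁, f₂} : Set _) by simp) y z hyz
      change r y = r z ⊓ (f₁ y ⊓ f₂ y)
      rw [← inf_assoc, ← hr₁, hr₂, inf_assoc, inf_idem]
  rw [hf.unique hq']
  rfl

/-- Currying. -/
def curry {γ : Type w} {α : Type u} {β : Type v} [PartialOrder γ] [PartialOrder α]
    [DIDomain β] (h : StableMap (γ × α) β) : StableMap γ (StableMap α β) where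
  toFun z := ⟨fun x => h (z, x), h.isStable.comp ((IsStable.const z).prodMk IsStable.id)⟩
  isStable := by
    have hx : ∀ x, IsStable fun z => h (z, x) := fun x =>
      h.isStable.comp (IsStable.id.prodMk (IsStable.const x))
    have hmono : ∀ z z' : γ, z ≤ z' → ∀ x y, x ≤ y → h (z, x) = h (z, y) ⊓ h (z', x) := by
      intro z z' hz x y hxy
      refine (h.isStable.map_isGLB (z, y) (z', x) (z, x) ⟨(z', y), ?_⟩ ?_).unique isGLB_pair
      · rintro _ (rfl | rfl)
        · exact ⟨hz, le_rfl⟩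
        · exact ⟨le_rfl, hxy⟩
      · constructor
        · rintro _ (rfl | rfl)
          · exact ⟨le_rfl, hxy⟩
          · exact ⟨hz, le_rfl⟩
        · intro p hp
          exact ⟨(hp (show (z, y) ∈ _ by simp)).1, (hp (show (z', x) ∈ _ by simp)).2⟩
    refine ⟨fun d hd hd' a ha => ⟨?_, fun g hg x y hxy => ?_⟩, fun z z' m hb hm => ⟨?_, ?_⟩⟩
    · rintro _ ⟨z, hz, rfl⟩
      exact hmono z a (ha.1 hz)
    · have ub : ∀ z ∈ d, ∀ x y, x ≤ y → h (z, x) = h (z, y) ⊓ g x := fun z hz =>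
        hg ⟨z, hz, rfl⟩
      change h (a, x) = h (a, y) ⊓ g x
      refine le_antisymm (le_inf (h.isStable.monotone ⟨le_rfl, hxy⟩)
        (((hx x).scottContinuous hd hd' ha).2 ?_)) ?_
      · rintro _ ⟨z, hz, rfl⟩
        exact (ub z hz x x le_rfl).le.trans inf_le_right
      · refine DIDomain.le_of_compact fun c hc hcb => ?_
        obtain ⟨z, hz, hcz⟩ := exists_le_of_isLUB_image hc hd
          (DirectedOn.mono_comp (fun _ _ h => (hx y).monotone h) hd')
          ((hx y).scottContinuous hd hd' ha) (hcb.trans inf_le_left)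
        refine le_trans ?_ ((hx x).monotone (ha.1 hz))
        rw [ub z hz x y hxy]
        exact le_inf hcz (hcb.trans inf_le_right)
    · rintro _ (rfl | rfl)
      · exact hmono m _ (hm.1 (by simp))
      · exact hmono m _ (hm.1 (by simp))
    · intro r hr x y hxy
      have hr₁ : r x = r y ⊓ h (z, x) := hr (mem_insert _ _) x y hxy
      have hr₂ : r x = r y ⊓ h (z', x) := hr (mem_insert_of_mem _ rfl) x y hxy
      have hm' : h (m, x) = h (z, x) ⊓ h (z', x) :=
        ((hx x).map_isGLB z z' m hb hm).unique isGLB_pair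
      change r x = r y ⊓ h (m, x)
      rw [hm', ← inf_assoc, ← hr₁, hr₂, inf_assoc, inf_idem]

/-- Uncurrying. -/
def uncurry {γ : Type w} {α : Type u} {β : Type v} [SemilatticeInf γ] [SemilatticeInf α]
    [DIDomain β] (h : StableMap γ (StableMap α β)) : StableMap (γ × α) β where
  toFun p := h p.1 p.2
  isStable := by
    refine ⟨?_, ?_⟩
    · refine ScottContinuous.fromProd (fun a => (h a).isStable.scottContinuous) ?_
      intro x d hd hd' a ha
      have := isLUB_apply (hd.image h)
        (DirectedOn.mono_comp (fun _ _ hab => h.isStable.monotone hab) hd')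
        (h.isStable.scottContinuous hd hd' ha) x
      rw [image_image] at this
      exact this
    · rintro ⟨x, y⟩ ⟨x', y'⟩ m ⟨⟨u, v⟩, huv⟩ hm
      obtain ⟨hxu, hyv⟩ : x ≤ u ∧ y ≤ v := huv (mem_insert _ _)
      obtain ⟨hxu', hyv'⟩ : x' ≤ u ∧ y' ≤ v := huv (mem_insert_of_mem _ rfl)
      have hbx : BddAbove {x, x'} := ⟨u, by rintro _ (rfl | rfl) <;> assumption⟩
      have hby : BddAbove {y, y'} := ⟨v, by rintro _ (rfl | rfl) <;> assumption⟩
      have hm₁ : IsGLB {x, x'} m.1 := by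
        have := (isGLB_prod.1 hm).1
        rwa [image_pair] at this
      have hm₂ : IsGLB {y, y'} m.2 := by
        have := (isGLB_prod.1 hm).2
        rwa [image_pair] at this
      have hbf : BddAbove {h x, h x'} := by
        have := h.isStable.monotone.map_bddAbove hbx
        rwa [image_pair] at this
      have e₁ := isGLB_apply hbf (h.isStable.map_isGLB x x' m.1 hbx hm₁) m.2
      have e₂ : (h x) m.2 = h x y ⊓ h x y' :=
        ((h x).isStable.map_isGLB y y' m.2 hby hm₂).unique isGLB_pair
      have e₃ : (h x') m.2 = h x' y ⊓ h x' y' :=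
        ((h x').isStable.map_isGLB y y' m.2 hby hm₂).unique isGLB_pair
      have hle : h x ≤ h u := h.isStable.monotone hxu
      have hle' : h x' ≤ h u := h.isStable.monotone hxu'
      have l₁ : h x y ⊓ h x' y' ≤ h x y' := by
        rw [hle y' v hyv']
        exact inf_le_inf ((h x).isStable.monotone hyv) (apply_le hle' y')
      have l₂ : h x y ⊓ h x' y' ≤ h x' y := by
        rw [hle' y v hyv, inf_comm]
        exact inf_le_inf ((h x').isStable.monotone hyv') (apply_le hle y)
      have : h m.1 m.2 = h x y ⊓ h x' y' := by
        refine le_antisymm ?_ ?_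
        · refine e₁.le.trans ?_
          rw [e₂, e₃]
          exact inf_le_inf inf_le_left inf_le_right
        · refine le_trans ?_ e₁.ge
          rw [e₂, e₃]
          exact le_inf (le_inf inf_le_left l₁) (le_inf l₂ inf_le_right)
      rw [this]
      exact isGLB_pair

/-- Composition. -/
def comp {γ : Type w} {α : Type u} {β : Type v} [PartialOrder γ] [PartialOrder α]
    [PartialOrder β] (g : StableMap α β) (f : StableMap γ α) : StableMap γ β :=
  ⟨fun x => g (f x), g.isStable.comp f.isStable⟩

end StableMap

/-- A stable model: a reflexive object `(U, App, Abs)` in the category of dI-domains and stable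
maps. -/
structure StableModel : Type (u + 1) where
  U : Type u
  [dom : DIDomain U]
  App : StableMap U (StableMap U U)
  Abs : StableMap (StableMap U U) U
  app_abs : ∀ f, App (Abs f) = f

namespace StableModel

attribute [instance] dom

variable (D : StableModel.{u})

/-- The map `x ↦ λy.x`. -/
def kMap : StableMap D.U D.U :=
  D.Abs.comp (StableMap.curry ⟨Prod.fst, IsStable.fst⟩)

/-- The map `((x, y), z) ↦ xz(yz)`. -/
def sMap₃ : StableMap ((D.U × D.U) × D.U) D.U where
  toFun p := D.App (D.App p.1.1 p.2) (D.App p.1.2 p.2)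
  isStable := by
    have h := (StableMap.uncurry D.App).isStable
    have h₁ : IsStable fun p : (D.U × D.U) × D.U => p.1.1 := IsStable.fst.comp IsStable.fst
    have h₂ : IsStable fun p : (D.U × D.U) × D.U => p.1.2 := IsStable.snd.comp IsStable.fst
    have h₃ : IsStable fun p : (D.U × D.U) × D.U => p.2 := IsStable.snd
    exact h.comp ((h.comp (h₁.prodMk h₃)).prodMk (h.comp (h₂.prodMk h₃)))

/-- The map `x ↦ λyz.xz(yz)`. -/
def sMap : StableMap D.U D.U :=
  D.Abs.comp (StableMap.curry (D.Abs.comp (StableMap.curry D.sMap₃)))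

/-- The combinatory algebra underlying the `λ`-model of the points of `U`:
`x · y = App(x)(y)`, `k = λxy.x` and `s = λxyz.xz(yz)`. -/
def toCombinatoryAlgebra : CombinatoryAlgebra.{u} where
  carrier := D.U
  app x y := D.App x y
  k := D.Abs D.kMap
  s := D.Abs D.sMap
  k_app x y := by
    rw [D.app_abs]
    change D.App (D.Abs _) y = x
    rw [D.app_abs]
    rfl
  s_app x y z := by
    rw [D.app_abs]
    change D.App (D.App (D.Abs _) y) z = _
    rw [D.app_abs]
    change D.App (D.Abs _) z = _
    rw [D.app_abs]
    rfl

end StableModel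

/-! ## The strongly stable semantics: dI-domains with coherence and strongly stable maps -/

/-- A distinguished family of subsets, called coherent. -/
class HasCoherence (α : Type u) where
  coh : Set (Set α)

open HasCoherence

/-- A dI-domain with coherence: a dI-domain with a family of non-empty finite subsets which contains
the singletons, is closed downwards for the Egli-Milner preorder, and is closed under least upper
bounds of directed sets. -/
class CoherentDIDomain (α : Type u) extends DIDomain α, HasCoherence α where
  finite_of_coh : ∀ A ∈ coh, A.Finite
  nonempty_of_coh : ∀ A ∈ coh, A.Nonempty
  singleton_coh : ∀ x : α, {x} ∈ coh
  coh_of_egliMilner : ∀ A ∈ coh, ∀ B : Set α, B.Finite → B.Nonempty →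
    (∀ b ∈ B, ∃ a ∈ A, b ≤ a) → (∀ a ∈ A, ∃ b ∈ B, b ≤ a) → B ∈ coh
  coh_of_directed : ∀ (n : ℕ) (D : Fin n → Set α) (d : Fin n → α),
    (∀ i, (D i).Nonempty ∧ DirectedOn (· ≤ ·) (D i) ∧ IsLUB (D i) (d i)) →
    (∀ x : Fin n → α, (∀ i, x i ∈ D i) → range x ∈ coh) → range d ∈ coh

/-- A map is strongly stable if it is Scott continuous, preserves coherence, and preserves the meets
of coherent sets. -/
structure IsStronglyStable {α : Type u} {β : Type v} [PartialOrder α] [PartialOrder β]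
    [HasCoherence α] [HasCoherence β] (f : α → β) : Prop where
  scottContinuous : ScottContinuous f
  map_coh : ∀ A ∈ coh (α := α), f '' A ∈ coh (α := β)
  map_isGLB : ∀ A ∈ coh (α := α), ∀ m, IsGLB A m → IsGLB (f '' A) (f m)

/-- Strongly stable maps. -/
structure StronglyStableMap (α : Type u) (β : Type v) [PartialOrder α] [PartialOrder β]
    [HasCoherence α] [HasCoherence β] where
  toFun : α → β
  isStronglyStable : IsStronglyStable toFun

/-- The coherence of a product: both projections are coherent. -/
instance {α : Type u} {β : Type v} [HasCoherence α] [HasCoherence β] : HasCoherence (α × β) where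
  coh := {A | Prod.fst '' A ∈ coh ∧ Prod.snd '' A ∈ coh}

namespace IsStronglyStable

variable {α : Type u} {β : Type v} {γ : Type w} [PartialOrder α] [PartialOrder β] [PartialOrder γ]
  [HasCoherence α] [HasCoherence β] [HasCoherence γ]

theorem monotone {f : α → β} (hf : IsStronglyStable f) : Monotone f :=
  hf.scottContinuous.monotone

theorem comp {g : β → γ} {f : α → β} (hg : IsStronglyStable g) (hf : IsStronglyStable f) :
    IsStronglyStable fun x => g (f x) where
  scottContinuous := hf.scottContinuous.comp hg.scottContinuous
  map_coh A hA := by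
    have := hg.map_coh _ (hf.map_coh A hA)
    rwa [image_image] at this
  map_isGLB A hA m hm := by
    have := hg.map_isGLB _ (hf.map_coh A hA) _ (hf.map_isGLB A hA m hm)
    rwa [image_image] at this

theorem fst : IsStronglyStable (Prod.fst : α × β → α) where
  scottContinuous := ScottContinuous.fst
  map_coh _ hA := hA.1
  map_isGLB _ _ _ hm := (isGLB_prod.1 hm).1

theorem snd : IsStronglyStable (Prod.snd : α × β → β) where
  scottContinuous := ScottContinuous.snd
  map_coh _ hA := hA.2
  map_isGLB _ _ _ hm := (isGLB_prod.1 hm).2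

theorem prodMk {f : γ → α} {g : γ → β} (hf : IsStronglyStable f) (hg : IsStronglyStable g) :
    IsStronglyStable fun x => (f x, g x) where
  scottContinuous := hf.scottContinuous.prodMk hg.scottContinuous
  map_coh A hA := by
    refine ⟨?_, ?_⟩
    · rw [image_image]
      exact hf.map_coh A hA
    · rw [image_image]
      exact hg.map_coh A hA
  map_isGLB A hA m hm := by
    refine isGLB_prod.2 ⟨?_, ?_⟩
    · rw [image_image]
      exact hf.map_isGLB A hA m hm
    · rw [image_image]
      exact hg.map_isGLB A hA m hm

end IsStronglyStable

namespace StronglyStableMap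

instance {α : Type u} {β : Type v} [PartialOrder α] [PartialOrder β] [HasCoherence α]
    [HasCoherence β] : FunLike (StronglyStableMap α β) α β where
  coe := toFun
  coe_injective f g h := by cases f; cases g; congr

/-- The function space carries the stable (Berry) order: `f ≤ g` if and only if
`f x = f y ⊓ g x` for all `x ≤ y`. -/
instance {α : Type u} {β : Type v} [PartialOrder α] [SemilatticeInf β] [HasCoherence α]
    [HasCoherence β] : PartialOrder (StronglyStableMap α β) where
  le f g := ∀ x y, x ≤ y → f x = f y ⊓ g x
  le_refl f x y h := (inf_eq_right.2 (f.isStronglyStable.monotone h)).symm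
  le_trans f g h h₁ h₂ x y hxy := by
    have hfg : f y ≤ g y := (h₁ y y le_rfl).le.trans inf_le_right
    rw [h₁ x y hxy, h₂ x y hxy, ← inf_assoc, inf_eq_left.2 hfg]
  le_antisymm f g h₁ h₂ := DFunLike.ext f g fun x => by
    rw [h₁ x x le_rfl, inf_comm, ← h₂ x x le_rfl]

/-- The coherence of the function space: a non-empty finite set `F` of maps, with meet `g`, is
coherent if for every coherent set `A` and every `M ⊆ F × A` that projects onto `F` and onto `A`,
the set of the values `f a`, `(f, a) ∈ M`, is coherent and its meet is `g (⋀ A)`. -/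
instance {α : Type u} {β : Type v} [PartialOrder α] [SemilatticeInf β] [HasCoherence α]
    [HasCoherence β] : HasCoherence (StronglyStableMap α β) where
  coh := {F | F.Finite ∧ F.Nonempty ∧ ∃ g, IsGLB F g ∧
    ∀ A ∈ coh (α := α), ∀ M : Set (StronglyStableMap α β × α),
      Prod.fst '' M = F → Prod.snd '' M = A →
        (fun p => p.1 p.2) '' M ∈ coh (α := β) ∧
        ∀ a, IsGLB A a → IsGLB ((fun p => p.1 p.2) '' M) (g a)}

theorem apply_le {α : Type u} {β : Type v} [PartialOrder α] [SemilatticeInf β] [HasCoherence α]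
    [HasCoherence β] {f g : StronglyStableMap α β} (h : f ≤ g) (x : α) : f x ≤ g x :=
  inf_eq_left.1 (h x x le_rfl).symm

theorem exists_upper_of_finite {ι : Type w} {α : Type u} [PartialOrder α] {F : Set α}
    (hne : F.Nonempty) (hF : DirectedOn (· ≤ ·) F) {s : Set ι} (hs : s.Finite) (φ : ι → α)
    (hφ : ∀ i ∈ s, φ i ∈ F) : ∃ g ∈ F, ∀ i ∈ s, φ i ≤ g := by
  induction s, hs using Set.Finite.induction_on with
  | empty => exact ⟨hne.some, hne.some_mem, by simp⟩
  | insert _ _ ih =>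
    obtain ⟨g, hg, h⟩ := ih fun i hi => hφ i (mem_insert_of_mem _ hi)
    obtain ⟨l, hl, h₁, h₂⟩ := hF _ (hφ _ (mem_insert _ _)) g hg
    refine ⟨l, hl, ?_⟩
    rintro i (rfl | hi)
    · exact h₁
    · exact (h i hi).trans h₂

theorem isLUB_apply {α : Type u} {β : Type v} [CoherentDIDomain α] [CoherentDIDomain β]
    {F : Set (StronglyStableMap α β)} (hne : F.Nonempty) (hF : DirectedOn (· ≤ ·) F)
    {f : StronglyStableMap α β} (hf : IsLUB F f) (x : α) :
    IsLUB ((fun g : StronglyStableMap α β => g x) '' F) (f x) := by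
  have hdir : ∀ x, DirectedOn (· ≤ ·) ((fun g : StronglyStableMap α β => g x) '' F) := fun x =>
    DirectedOn.mono_comp (fun _ _ h => apply_le h x) hF
  have hlub := fun x => (hdir x).isLUB_sSup
  have hcpt : ∀ x c, IsCompactElement c →
      c ≤ sSup ((fun g : StronglyStableMap α β => g x) '' F) → ∃ g ∈ F, c ≤ g x :=
    fun x c hc h => exists_le_of_isLUB_image hc hne (hdir x) (hlub x) h
  have hmono : Monotone fun x => sSup ((fun g : StronglyStableMap α β => g x) '' F) := by
    intro y z hyz
    refine (hlub y).2 ?_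
    rintro _ ⟨g, hg, rfl⟩
    exact (g.isStronglyStable.monotone hyz).trans ((hlub z).1 ⟨g, hg, rfl⟩)
  have hp : IsStronglyStable fun x => sSup ((fun g : StronglyStableMap α β => g x) '' F) := by
    refine ⟨fun d hd hd' a ha => ⟨?_, fun b hb => ?_⟩, fun A hA => ?_,
      fun A hA m hm => ⟨?_, fun b hb => ?_⟩⟩
    · rintro _ ⟨z, hz, rfl⟩
      exact hmono (ha.1 hz)
    · refine (hlub a).2 ?_
      rintro _ ⟨g, hg, rfl⟩
      refine (g.isStronglyStable.scottContinuous hd hd' ha).2 ?_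
      rintro _ ⟨z, hz, rfl⟩
      exact ((hlub z).1 ⟨g, hg, rfl⟩).trans (hb ⟨z, hz, rfl⟩)
    · have hfin := CoherentDIDomain.finite_of_coh A hA
      obtain ⟨n, a, rfl⟩ : ∃ (n : ℕ) (a : Fin n → α), A = range a := by
        obtain ⟨n, a, -, ha⟩ := hfin.fin_param
        exact ⟨n, a, ha.symm⟩
      rw [← range_comp]
      have : Nonempty (Fin n) := range_nonempty_iff_nonempty.1
        (CoherentDIDomain.nonempty_of_coh _ hA)
      refine CoherentDIDomain.coh_of_directed n
        (fun i => (fun g : StronglyStableMap α β => g (a i)) '' F) _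
        (fun i => ⟨hne.image _, hdir _, hlub _⟩) ?_
      intro y hy
      choose φ hφ hφy using hy
      obtain ⟨g, hg, hle⟩ := exists_upper_of_finite hne hF (finite_univ (α := Fin n)) φ
        fun i _ => hφ i
      have hyg : ∀ i, y i ≤ g (a i) := fun i =>
        (hφy i).ge.trans (apply_le (hle i (mem_univ i)) _)
      refine CoherentDIDomain.coh_of_egliMilner _ (g.isStronglyStable.map_coh _ hA) _
        (finite_range y) (range_nonempty y) ?_ ?_
      · rintro _ ⟨i, rfl⟩
        exact ⟨_, ⟨a i, ⟨i, rfl⟩, rfl⟩, hyg i⟩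
      · rintro _ ⟨_, ⟨i, rfl⟩, rfl⟩
        exact ⟨_, ⟨i, rfl⟩, hyg i⟩
    · rintro _ ⟨z, hz, rfl⟩
      exact hmono (hm.1 hz)
    · refine DIDomain.le_of_compact fun c hc hcb => ?_
      have hex : ∀ z : α, ∃ g : StronglyStableMap α β, z ∈ A → g ∈ F ∧ c ≤ g z := by
        intro z
        by_cases hz : z ∈ A
        · obtain ⟨g, hg, hcg⟩ := hcpt z c hc (hcb.trans (hb ⟨z, hz, rfl⟩))
          exact ⟨g, fun _ => ⟨hg, hcg⟩⟩
        · exact ⟨hne.some, fun h => absurd h hz⟩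
      choose φ hφ using hex
      obtain ⟨g, hg, hle⟩ := exists_upper_of_finite hne hF
        (CoherentDIDomain.finite_of_coh A hA) φ fun z hz => (hφ z hz).1
      refine le_trans ?_ ((hlub m).1 ⟨g, hg, rfl⟩)
      refine (g.isStronglyStable.map_isGLB A hA m hm).2 ?_
      rintro _ ⟨z, hz, rfl⟩
      exact (hφ z hz).2.trans (apply_le (hle z hz) z)
  have hp' : IsLUB F (⟨_, hp⟩ : StronglyStableMap α β) := by
    constructor
    · intro g hg y z hyz
      refine le_antisymm (le_inf (g.isStronglyStable.monotone hyz) ((hlub y).1 ⟨g, hg, rfl⟩)) ?_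
      refine DIDomain.le_of_compact fun c hc hcb => ?_
      obtain ⟨h, hh, hch⟩ := hcpt y c hc (hcb.trans inf_le_right)
      obtain ⟨l, hl, hgl, hhl⟩ := hF g hg h hh
      rw [hgl y z hyz]
      exact le_inf (hcb.trans inf_le_left) (hch.trans (apply_le hhl _))
    · intro g hg y z hyz
      refine le_antisymm (le_inf (hmono hyz) ((hlub y).2 ?_)) ?_
      · rintro _ ⟨h, hh, rfl⟩
        exact apply_le (hg hh) y
      · refine DIDomain.le_of_compact fun c hc hcb => ?_
        obtain ⟨h, hh, hch⟩ := hcpt z c hc (hcb.trans inf_le_left)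
        refine le_trans ?_ ((hlub y).1 ⟨h, hh, rfl⟩)
        change c ≤ h y
        rw [hg hh y z hyz]
        exact le_inf hch (hcb.trans inf_le_right)
  rw [hf.unique hp']
  exact hlub x

/-- The three closure properties of the coherence of an object that currying uses. -/
structure Admissible (γ : Type w) [PartialOrder γ] [HasCoherence γ] : Prop where
  finite_nonempty : ∀ A ∈ coh (α := γ), A.Finite ∧ A.Nonempty
  exists_isGLB : ∀ A ∈ coh (α := γ), ∃ m, IsGLB A m
  pair : ∀ x y : γ, x ≤ y → {x, y} ∈ coh (α := γ)

theorem admissible_of_coherentDIDomain (γ : Type w) [CoherentDIDomain γ] : Admissible γ where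
  finite_nonempty A hA :=
    ⟨CoherentDIDomain.finite_of_coh A hA, CoherentDIDomain.nonempty_of_coh A hA⟩
  exists_isGLB A hA := by
    have hf := CoherentDIDomain.finite_of_coh A hA
    have hn := CoherentDIDomain.nonempty_of_coh A hA
    lift A to Finset γ using hf
    exact ⟨_, Finset.isGLB_inf' (s := A) (Finset.coe_nonempty.1 hn)⟩
  pair x y hxy := by
    refine CoherentDIDomain.coh_of_egliMilner _ (CoherentDIDomain.singleton_coh y) _
      (by simp) (by simp) ?_ ?_
    · rintro _ (rfl | rfl)
      · exact ⟨y, rfl, hxy⟩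
      · exact ⟨_, rfl, le_rfl⟩
    · rintro _ rfl
      exact ⟨x, mem_insert _ _, hxy⟩

theorem Admissible.prod {γ : Type w} {δ : Type v} [PartialOrder γ] [HasCoherence γ]
    [PartialOrder δ] [HasCoherence δ] (hγ : Admissible γ) (hδ : Admissible δ) :
    Admissible (γ × δ) where
  finite_nonempty A hA :=
    ⟨((hγ.finite_nonempty _ hA.1).1.prod (hδ.finite_nonempty _ hA.2).1).subset
      subset_fst_image_prod_snd_image, (hγ.finite_nonempty _ hA.1).2.of_image⟩
  exists_isGLB A hA := by
    obtain ⟨m, hm⟩ := hγ.exists_isGLB _ hA.1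
    obtain ⟨n, hn⟩ := hδ.exists_isGLB _ hA.2
    exact ⟨(m, n), isGLB_prod.2 ⟨hm, hn⟩⟩
  pair x y hxy := by
    refine ⟨?_, ?_⟩
    · rw [image_pair]
      exact hγ.pair _ _ hxy.1
    · rw [image_pair]
      exact hδ.pair _ _ hxy.2

/-- Currying. -/
def curry {γ : Type w} {α : Type u} {β : Type v} [PartialOrder γ] [HasCoherence γ]
    [CoherentDIDomain α] [CoherentDIDomain β] (hγ : Admissible γ)
    (h : StronglyStableMap (γ × α) β) : StronglyStableMap γ (StronglyStableMap α β) where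
  toFun z :=
    { toFun := fun x => h (z, x)
      isStronglyStable := by
        have hz : IsStronglyStable fun x : α => ((z, x) : γ × α) := by
          refine ⟨(ScottContinuous.const z).prodMk ScottContinuous.id, fun A hA => ⟨?_, ?_⟩,
            fun A hA m hm => isGLB_prod.2 ⟨?_, ?_⟩⟩
          · rw [image_image, (CoherentDIDomain.nonempty_of_coh A hA).image_const]
            simpa using hγ.pair z z le_rfl
          · rw [image_image, image_id']
            exact hA
          · rw [image_image, (CoherentDIDomain.nonempty_of_coh A hA).image_const]
            exact isGLB_singleton
          · rw [image_image, image_id']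
            exact hm
        exact h.isStronglyStable.comp hz }
  isStronglyStable := by
    have hα := admissible_of_coherentDIDomain α
    have hx : ∀ x, IsStronglyStable fun z => h (z, x) := by
      intro x
      have hz : IsStronglyStable fun z : γ => ((z, x) : γ × α) := by
        refine ⟨ScottContinuous.id.prodMk (ScottContinuous.const x), fun A hA => ⟨?_, ?_⟩,
          fun A hA m hm => isGLB_prod.2 ⟨?_, ?_⟩⟩
        · rw [image_image, image_id']
          exact hA
        · rw [image_image, (hγ.finite_nonempty A hA).2.image_const]
          exact CoherentDIDomain.singleton_coh x
        · rw [image_image, image_id']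
          exact hm
        · rw [image_image, (hγ.finite_nonempty A hA).2.image_const]
          exact isGLB_singleton
      exact h.isStronglyStable.comp hz
    have hmono : ∀ z z' : γ, z ≤ z' → ∀ x y, x ≤ y → h (z, x) = h (z, y) ⊓ h (z', x) := by
      intro z z' hz x y hxy
      have hc : {(z, y), (z', x)} ∈ coh (α := γ × α) := by
        refine ⟨?_, ?_⟩
        · rw [image_pair]
          exact hγ.pair z z' hz
        · rw [image_pair, pair_comm]
          exact hα.pair x y hxy
      have hg : IsGLB {(z, y), (z', x)} (z, x) := by
        constructor
        · rintro _ (rfl | rfl)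
          · exact ⟨le_rfl, hxy⟩
          · exact ⟨hz, le_rfl⟩
        · intro p hp
          exact ⟨(hp (show (z, y) ∈ _ by simp)).1, (hp (show (z', x) ∈ _ by simp)).2⟩
      have := h.isStronglyStable.map_isGLB _ hc _ hg
      rw [image_pair] at this
      exact this.unique isGLB_pair
    have hglb : ∀ B ∈ coh (α := γ), ∀ m, IsGLB B m → ∀ (e : γ → StronglyStableMap α β),
        (∀ z x, e z x = h (z, x)) → IsGLB (e '' B) (e m) := by
      intro B hB m hm e he
      constructor
      · rintro _ ⟨z, hz, rfl⟩ x y hxy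
        simp only [he]
        exact hmono m z (hm.1 hz) x y hxy
      · intro r hr x y hxy
        have hr' : ∀ z ∈ B, r x = r y ⊓ h (z, x) := fun z hz => by
          rw [← he]
          exact hr ⟨z, hz, rfl⟩ x y hxy
        rw [he]
        refine le_antisymm (le_inf (r.isStronglyStable.monotone hxy)
          (((hx x).map_isGLB B hB m hm).2 ?_)) ?_
        · rintro _ ⟨z, hz, rfl⟩
          exact (hr' z hz).le.trans inf_le_right
        · obtain ⟨z, hz⟩ := (hγ.finite_nonempty B hB).2
          rw [hr' z hz]
          exact inf_le_inf le_rfl ((hx x).monotone (hm.1 hz))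
    refine ⟨fun d hd hd' a ha => ⟨?_, fun g hg x y hxy => ?_⟩, fun B hB => ?_,
      fun B hB m hm => hglb B hB m hm _ fun _ _ => rfl⟩
    · rintro _ ⟨z, hz, rfl⟩
      exact hmono z a (ha.1 hz)
    · have ub : ∀ z ∈ d, ∀ x y, x ≤ y → h (z, x) = h (z, y) ⊓ g x := fun z hz =>
        hg ⟨z, hz, rfl⟩
      change h (a, x) = h (a, y) ⊓ g x
      refine le_antisymm (le_inf (h.isStronglyStable.monotone ⟨le_rfl, hxy⟩)
        (((hx x).scottContinuous hd hd' ha).2 ?_)) ?_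
      · rintro _ ⟨z, hz, rfl⟩
        exact (ub z hz x x le_rfl).le.trans inf_le_right
      · refine DIDomain.le_of_compact fun c hc hcb => ?_
        obtain ⟨z, hz, hcz⟩ := exists_le_of_isLUB_image hc hd
          (DirectedOn.mono_comp (fun _ _ h => (hx y).monotone h) hd')
          ((hx y).scottContinuous hd hd' ha) (hcb.trans inf_le_left)
        refine le_trans ?_ ((hx x).monotone (ha.1 hz))
        rw [ub z hz x y hxy]
        exact le_inf hcz (hcb.trans inf_le_right)
    · obtain ⟨m, hm⟩ := hγ.exists_isGLB B hB
      refine ⟨(hγ.finite_nonempty B hB).1.image _, (hγ.finite_nonempty B hB).2.image _, _,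
        hglb B hB m hm _ fun _ _ => rfl, ?_⟩
      intro A hA M hM₁ hM₂
      set e : γ → StronglyStableMap α β := fun z => ⟨fun x => h (z, x), _⟩ with he
      let N : Set (γ × α) := {p | p.1 ∈ B ∧ (e p.1, p.2) ∈ M}
      have hN₁ : Prod.fst '' N = B := by
        ext z
        constructor
        · rintro ⟨p, hp, rfl⟩
          exact hp.1
        · intro hz
          have : e z ∈ Prod.fst '' M := hM₁ ▸ mem_image_of_mem e hz
          obtain ⟨⟨f, x⟩, hp, hpe⟩ := this
          obtain rfl : f = e z := hpe
          exact ⟨(z, x), ⟨hz, hp⟩, rfl⟩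
      have hN₂ : Prod.snd '' N = A := by
        ext x
        constructor
        · rintro ⟨p, hp, rfl⟩
          rw [← hM₂]
          exact ⟨_, hp.2, rfl⟩
        · intro hxA
          rw [← hM₂] at hxA
          obtain ⟨⟨f, x'⟩, hp, hpe⟩ := hxA
          obtain rfl : x' = x := hpe
          have : f ∈ e '' B := hM₁ ▸ mem_image_of_mem Prod.fst hp
          obtain ⟨z, hz, rfl⟩ := this
          exact ⟨(z, x'), ⟨hz, hp⟩, rfl⟩
      have hval : (fun p : StronglyStableMap α β × α => p.1 p.2) '' M = h '' N := by
        ext b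
        constructor
        · rintro ⟨⟨f, x⟩, hp, rfl⟩
          have : f ∈ e '' B := hM₁ ▸ mem_image_of_mem Prod.fst hp
          obtain ⟨z, hz, rfl⟩ := this
          exact ⟨(z, x), ⟨hz, hp⟩, rfl⟩
        · rintro ⟨⟨z, x⟩, hp, rfl⟩
          exact ⟨(e z, x), hp.2, rfl⟩
      have hN : N ∈ coh (α := γ × α) := ⟨hN₁ ▸ hB, hN₂ ▸ hA⟩
      rw [hval]
      refine ⟨h.isStronglyStable.map_coh N hN, fun a ha => ?_⟩
      exact h.isStronglyStable.map_isGLB N hN (m, a)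
        (isGLB_prod.2 ⟨by rw [hN₁]; exact hm, by rw [hN₂]; exact ha⟩)

/-- Uncurrying. -/
def uncurry {γ : Type w} {α : Type u} {β : Type v} [PartialOrder γ] [HasCoherence γ]
    [CoherentDIDomain α] [CoherentDIDomain β]
    (h : StronglyStableMap γ (StronglyStableMap α β)) : StronglyStableMap (γ × α) β where
  toFun p := h p.1 p.2
  isStronglyStable := by
    have key : ∀ N ∈ coh (α := γ × α), (fun p : γ × α => h p.1 p.2) '' N ∈ coh (α := β) ∧
        ∀ m, IsGLB N m → IsGLB ((fun p : γ × α => h p.1 p.2) '' N) (h m.1 m.2) := by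
      intro N hN
      obtain ⟨-, -, g, hg, hM⟩ := h.isStronglyStable.map_coh _ hN.1
      have := hM _ hN.2 ((fun p : γ × α => (h p.1, p.2)) '' N)
        (by rw [image_image, image_image]; rfl) (by rw [image_image])
      rw [image_image] at this
      refine ⟨this.1, fun m hm => ?_⟩
      have e : h m.1 = g :=
        (h.isStronglyStable.map_isGLB _ hN.1 _ (isGLB_prod.1 hm).1).unique hg
      rw [e]
      exact this.2 _ (isGLB_prod.1 hm).2
    refine ⟨?_, fun N hN => (key N hN).1, fun N hN => (key N hN).2⟩
    refine ScottContinuous.fromProd (fun a => (h a).isStronglyStable.scottContinuous) ?_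
    intro x d hd hd' a ha
    have := isLUB_apply (hd.image h)
      (DirectedOn.mono_comp (fun _ _ hab => h.isStronglyStable.monotone hab) hd')
      (h.isStronglyStable.scottContinuous hd hd' ha) x
    rw [image_image] at this
    exact this

/-- Composition. -/
def comp {γ : Type w} {α : Type u} {β : Type v} [PartialOrder γ] [PartialOrder α]
    [PartialOrder β] [HasCoherence γ] [HasCoherence α] [HasCoherence β]
    (g : StronglyStableMap α β) (f : StronglyStableMap γ α) : StronglyStableMap γ β :=
  ⟨fun x => g (f x), g.isStronglyStable.comp f.isStronglyStable⟩

end StronglyStableMap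

/-- A strongly stable model: a reflexive object `(U, App, Abs)` in the category of dI-domains with
coherence and strongly stable maps. -/
structure StronglyStableModel : Type (u + 1) where
  U : Type u
  [dom : CoherentDIDomain U]
  App : StronglyStableMap U (StronglyStableMap U U)
  Abs : StronglyStableMap (StronglyStableMap U U) U
  app_abs : ∀ f, App (Abs f) = f

namespace StronglyStableModel

attribute [instance] dom

variable (D : StronglyStableModel.{u})

/-- The map `x ↦ λy.x`. -/
def kMap : StronglyStableMap D.U D.U :=
  D.Abs.comp (StronglyStableMap.curry (StronglyStableMap.admissible_of_coherentDIDomain _)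
    ⟨Prod.fst, IsStronglyStable.fst⟩)

/-- The map `((x, y), z) ↦ xz(yz)`. -/
def sMap₃ : StronglyStableMap ((D.U × D.U) × D.U) D.U where
  toFun p := D.App (D.App p.1.1 p.2) (D.App p.1.2 p.2)
  isStronglyStable := by
    have h := (StronglyStableMap.uncurry D.App).isStronglyStable
    have h₁ : IsStronglyStable fun p : (D.U × D.U) × D.U => p.1.1 :=
      IsStronglyStable.fst.comp IsStronglyStable.fst
    have h₂ : IsStronglyStable fun p : (D.U × D.U) × D.U => p.1.2 :=
      IsStronglyStable.snd.comp IsStronglyStable.fst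
    have h₃ : IsStronglyStable fun p : (D.U × D.U) × D.U => p.2 := IsStronglyStable.snd
    exact h.comp ((h.comp (h₁.prodMk h₃)).prodMk (h.comp (h₂.prodMk h₃)))

/-- The map `x ↦ λyz.xz(yz)`. -/
def sMap : StronglyStableMap D.U D.U :=
  D.Abs.comp (StronglyStableMap.curry (StronglyStableMap.admissible_of_coherentDIDomain _)
    (D.Abs.comp (StronglyStableMap.curry
      ((StronglyStableMap.admissible_of_coherentDIDomain _).prod
        (StronglyStableMap.admissible_of_coherentDIDomain _)) D.sMap₃)))

/-- The combinatory algebra underlying the `λ`-model of the points of `U`: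
`x · y = App(x)(y)`, `k = λxy.x` and `s = λxyz.xz(yz)`. -/
def toCombinatoryAlgebra : CombinatoryAlgebra.{u} where
  carrier := D.U
  app x y := D.App x y
  k := D.Abs D.kMap
  s := D.Abs D.sMap
  k_app x y := by
    rw [D.app_abs]
    change D.App (D.Abs _) y = x
    rw [D.app_abs]
    rfl
  s_app x y z := by
    rw [D.app_abs]
    change D.App (D.App (D.Abs _) y) z = _
    rw [D.app_abs]
    change D.App (D.Abs _) z = _
    rw [D.app_abs]
    rfl

end StronglyStableModel

/-! ## `λ`-terms, `λ`-theories and term models -/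

/-- `λ`-terms up to `α`-equivalence, in de Bruijn notation: `var n` below `d` abstractions is bound
if `n < d` and otherwise stands for the free variable `n - d`. -/
inductive LambdaTerm : Type
  | var : ℕ → LambdaTerm
  | app : LambdaTerm → LambdaTerm → LambdaTerm
  | lam : LambdaTerm → LambdaTerm

namespace LambdaTerm

/-- Extend a renaming below an abstraction. -/
def liftRen (ρ : ℕ → ℕ) : ℕ → ℕ
  | 0 => 0
  | n + 1 => ρ n + 1

/-- Renaming of free variables. -/
def rename : (ℕ → ℕ) → LambdaTerm → LambdaTerm
  | ρ, var n => var (ρ n)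
  | ρ, app M N => app (rename ρ M) (rename ρ N)
  | ρ, lam M => lam (rename (liftRen ρ) M)

/-- Extend a substitution below an abstraction. -/
def liftSub (σ : ℕ → LambdaTerm) : ℕ → LambdaTerm
  | 0 => var 0
  | n + 1 => rename Nat.succ (σ n)

/-- Simultaneous capture-avoiding substitution. -/
def subst : (ℕ → LambdaTerm) → LambdaTerm → LambdaTerm
  | σ, var n => σ n
  | σ, app M N => app (subst σ M) (subst σ N)
  | σ, lam M => lam (subst (liftSub σ) M)

/-- The substitution of `N` for the variable `0`, which renumbers the other variables. -/
def single (N : LambdaTerm) : ℕ → LambdaTerm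
  | 0 => N
  | n + 1 => var n

/-- `M[N/x]`, where `x` is the variable bound by `lam M`. -/
def inst (M N : LambdaTerm) : LambdaTerm := subst (single N) M

/-- `β`-conversion. -/
inductive BetaEq : LambdaTerm → LambdaTerm → Prop
  | beta (M N) : BetaEq (app (lam M) N) (inst M N)
  | refl (M) : BetaEq M M
  | symm {M N} : BetaEq M N → BetaEq N M
  | trans {M N P} : BetaEq M N → BetaEq N P → BetaEq M P
  | app {M M' N N'} : BetaEq M M' → BetaEq N N' → BetaEq (app M N) (app M' N')
  | lam {M M'} : BetaEq M M' → BetaEq (lam M) (lam M')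

/-- `lams n M` is `λx₁…xₙ.M`. -/
def lams : ℕ → LambdaTerm → LambdaTerm
  | 0, M => M
  | n + 1, M => lam (lams n M)

/-- `apps M [M₁, …, Mₖ]` is `M M₁ ⋯ Mₖ`. -/
def apps (M : LambdaTerm) (Ms : List LambdaTerm) : LambdaTerm := Ms.foldl app M

/-- A term is solvable if it is `β`-convertible to a head normal form `λx₁…xₙ.y M₁⋯Mₖ`, where the
head `y` is a variable, bound or free. -/
def Solvable (M : LambdaTerm) : Prop :=
  ∃ (n i : ℕ) (Ms : List LambdaTerm), BetaEq M (lams n (apps (var i) Ms))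

theorem subst_rename : ∀ (M : LambdaTerm) (ρ : ℕ → ℕ) (σ τ : ℕ → LambdaTerm),
    (∀ n, σ (ρ n) = τ n) → subst σ (rename ρ M) = subst τ M := by
  intro M
  induction M with
  | var n =>
    intro ρ σ τ h
    exact h n
  | app M N ihM ihN =>
    intro ρ σ τ h
    simp only [rename, subst, ihM ρ σ τ h, ihN ρ σ τ h]
  | lam M ih =>
    intro ρ σ τ h
    simp only [rename, subst]
    rw [ih (liftRen ρ) (liftSub σ) (liftSub τ)]
    rintro (_ | n)
    · rfl
    · simp only [liftRen, liftSub, h n]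

theorem subst_var : ∀ (M : LambdaTerm) (σ : ℕ → LambdaTerm), (∀ n, σ n = var n) →
    subst σ M = M := by
  intro M
  induction M with
  | var n =>
    intro σ h
    exact h n
  | app M N ihM ihN =>
    intro σ h
    simp only [subst, ihM σ h, ihN σ h]
  | lam M ih =>
    intro σ h
    simp only [subst]
    rw [ih (liftSub σ)]
    rintro (_ | n)
    · rfl
    · simp only [liftSub, h n, rename]

theorem inst_rename_succ (M N : LambdaTerm) : subst (single N) (rename Nat.succ M) = M := by
  rw [subst_rename M Nat.succ (single N) var fun _ => rfl]
  exact subst_var M var fun _ => rfl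

theorem inst_rename_succ_two (M N : LambdaTerm) :
    subst (liftSub (single N)) (rename Nat.succ (rename Nat.succ M)) = rename Nat.succ M := by
  rw [subst_rename (rename Nat.succ M) Nat.succ _ (fun n => rename Nat.succ (single N n))
    fun _ => rfl]
  rw [subst_rename M Nat.succ (fun n => rename Nat.succ (single N n)) (fun n => var (n + 1))
    fun _ => rfl]
  rw [← subst_rename M Nat.succ var (fun n => var (n + 1)) fun _ => rfl]
  exact subst_var _ var fun _ => rfl

end LambdaTerm

open LambdaTerm in
/-- A `λ`-theory: a congruence on `λ`-terms that contains `β`-conversion (`α`-equivalent terms are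
identified). -/
structure LambdaTheory where
  rel : LambdaTerm → LambdaTerm → Prop
  equivalence : Equivalence rel
  app_congr : ∀ {M M' N N'}, rel M M' → rel N N' → rel (app M N) (app M' N')
  lam_congr : ∀ {M M'}, rel M M' → rel (lam M) (lam M')
  beta : ∀ M N, rel (app (lam M) N) (inst M N)

namespace LambdaTheory

open LambdaTerm

/-- A `λ`-theory is semi-sensible if it equates no solvable term with an unsolvable one. -/
def SemiSensible (T : LambdaTheory) : Prop :=
  ∀ M N, T.rel M N → Solvable M → Solvable N

/-- Equality in the theory. -/
def setoid (T : LambdaTheory) : Setoid LambdaTerm := ⟨T.rel, T.equivalence⟩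

/-- The combinatory algebra underlying the term model of `T`: the (open) `λ`-terms modulo `T`, with
`k = [λxy.x]` and `s = [λxyz.xz(yz)]`. -/
def termModel (T : LambdaTheory) : CombinatoryAlgebra.{0} where
  carrier := Quotient T.setoid
  app := Quotient.map₂ app fun _ _ h _ _ h' => T.app_congr h h'
  k := Quotient.mk _ (lam (lam (var 1)))
  s := Quotient.mk _
    (lam (lam (lam (app (app (var 2) (var 0)) (app (var 1) (var 0))))))
  k_app x y := by
    induction x using Quotient.inductionOn with | _ M
    induction y using Quotient.inductionOn with | _ N
    refine Quotient.sound ?_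
    have h₁ : T.rel (app (lam (lam (var 1))) M) (lam (rename Nat.succ M)) := T.beta _ _
    have h₂ : T.rel (app (lam (rename Nat.succ M)) N) M := by
      have := T.beta (rename Nat.succ M) N
      rwa [inst, inst_rename_succ] at this
    exact T.equivalence.trans (T.app_congr h₁ (T.equivalence.refl N)) h₂
  s_app x y z := by
    induction x using Quotient.inductionOn with | _ M
    induction y using Quotient.inductionOn with | _ N
    induction z using Quotient.inductionOn with | _ P
    refine Quotient.sound ?_
    have h₁ := T.beta
      (lam (lam (app (app (var 2) (var 0)) (app (var 1) (var 0))))) M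
    have h₂ := T.beta (lam (app (app (rename Nat.succ (rename Nat.succ M)) (var 0))
      (app (var 1) (var 0)))) N
    have h₃ := T.beta (app (app (rename Nat.succ M) (var 0))
      (app (rename Nat.succ N) (var 0))) P
    simp only [inst, subst, single, liftSub, rename, inst_rename_succ,
      inst_rename_succ_two] at h₁ h₂ h₃
    have h₄ := T.app_congr (T.app_congr h₁ (T.equivalence.refl N)) (T.equivalence.refl P)
    have h₅ := T.app_congr h₂ (T.equivalence.refl P)
    exact T.equivalence.trans h₄ (T.equivalence.trans h₅ h₃)

end LambdaTheory

/-! ## Direct indecomposability from two-valued elements -/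

/-! Suppose that `A ≅ B × C` with both factors non-trivial. Application is componentwise, and both
halves of the theorem find an element whose behaviour is incompatible with this.

For the domain models the obstruction is a function with only two values. If `g` fixes `b`, sends
`q` to `c` and takes no other value, then the mixed point `(q₁, b₂)` must go to `(c₁, b₂)`, which is
neither `b` nor `c` once `c` differs from `b` in both coordinates. With `b = ⊥` such functions are
step maps, equal to `c` on a Scott open set and to `⊥` elsewhere: the non-bottom elements serve for
cpos, the elements above a compact `p ≰ ⊥` for dI-domains, with or without coherence
(`isStable_stepMap`, `isStronglyStable_stepMap`). Every morphism is represented by a point of the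
model because `App ∘ Abs = id`.

For term models the decomposition itself provides `e` with `exy = (x₁, y₂)`, hence `exx = x`. By
semi-sensibility `exx` is solvable, and remains so after the free variables of `e` are replaced by
the unsolvable term Ω. Intersection types, read as a graph model, detect this: solvable terms have a
type (`Solvable.exists_mem_types`), Ω has none (`types_omega`). If both `x` and `y` carry all types,
then `exx` and `exy` have the same types, so `exy` is typable with no type given to the free
variables of `e`. Realizability (`subst_mem_realizers`) turns this typing into a conversion from
`exyx⋯x` to a term with head `x` or `y`. Now let the head argument be a function that swallows its
arguments and returns a fixed element, while the other argument, which still controls one coordinate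
of `exy`, forces a different value in that coordinate: a contradiction. -/

/-- In a product, an element acting as a function with two values must have values that agree in
some component. -/
theorem CombinatoryAlgebra.directlyIndecomposable_of_twoValued (A : CombinatoryAlgebra.{u})
    (b : A.carrier)
    (h : Nontrivial A.carrier → ∃ q, ∀ c, ∃ g, A.app g b = b ∧ A.app g q = c ∧
      ∀ x, A.app g x = b ∨ A.app g x = c) :
    A.DirectlyIndecomposable := by
  rintro ⟨B, C, hB, hC, ⟨φ⟩⟩
  obtain ⟨ψ, hψ⟩ : ∃ ψ : A.carrier ≃ B.carrier × C.carrier, ∀ x y,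
      ψ (A.app x y) = (B.app (ψ x).1 (ψ y).1, C.app (ψ x).2 (ψ y).2) :=
    ⟨φ.toEquiv, φ.map_app⟩
  obtain ⟨q, hq⟩ := h ψ.nontrivial
  obtain ⟨c₁, hc₁⟩ := exists_ne (ψ b).1
  obtain ⟨c₂, hc₂⟩ := exists_ne (ψ b).2
  -- The target `c` differs from `b` in both coordinates; this is possible because `q` was fixed
  -- independently of `c`.
  obtain ⟨g, hgb, hgq, hg⟩ := hq (ψ.symm (c₁, c₂))
  have eb := hψ g b
  have eq := hψ g q
  -- The mixed point `(q₁, b₂)`: its image has first coordinate that of `c` and second coordinate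
  -- that of `b`.
  have ex := hψ g (ψ.symm ((ψ q).1, (ψ b).2))
  rw [hgb] at eb
  rw [hgq, Equiv.apply_symm_apply] at eq
  rw [Equiv.apply_symm_apply] at ex
  rcases hg (ψ.symm ((ψ q).1, (ψ b).2)) with hx | hx
  · rw [hx] at ex
    exact hc₁ ((congrArg Prod.fst eq).trans (congrArg Prod.fst ex).symm)
  · rw [hx, Equiv.apply_symm_apply] at ex
    exact hc₂ ((congrArg Prod.snd ex).trans (congrArg Prod.snd eb).symm)

/-! ## Step maps -/

open Classical in
/-- The map with value `c` on the elements satisfying `P` and `b` elsewhere. -/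
noncomputable def stepMap {α : Type u} {β : Type v} (P : α → Prop) (b c : β) (x : α) : β :=
  if P x then c else b

section stepMap

variable {α : Type u} {β : Type v} {P : α → Prop} {b c : β}

theorem stepMap_of_pos {x : α} (h : P x) : stepMap P b c x = c := if_pos h

theorem stepMap_of_neg {x : α} (h : ¬ P x) : stepMap P b c x = b := if_neg h

theorem stepMap_eq_or (x : α) : stepMap P b c x = b ∨ stepMap P b c x = c := by
  by_cases h : P x
  · exact .inr (stepMap_of_pos h)
  · exact .inl (stepMap_of_neg h)

theorem stepMap_le [PartialOrder β] (hbc : b ≤ c) (x : α) : stepMap P b c x ≤ c := by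
  rcases stepMap_eq_or (P := P) (b := b) (c := c) x with h | h <;> rw [h]
  exact hbc

/-- The hypotheses say that `P` is Scott open. A directed set whose supremum is in `P` meets `P`, so
`c` is attained and is the largest value; otherwise the set misses `P` and its image is `{b}`. -/
theorem scottContinuous_stepMap [PartialOrder α] [PartialOrder β]
    (hup : ∀ x y, x ≤ y → P x → P y)
    (hin : ∀ d : Set α, d.Nonempty → DirectedOn (· ≤ ·) d → ∀ a, IsLUB d a → P a → ∃ x ∈ d, P x)
    (hbc : b ≤ c) : ScottContinuous (stepMap P b c) := by
  intro d hd hd' a ha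
  by_cases hPa : P a
  · rw [stepMap_of_pos hPa]
    obtain ⟨x, hx, hPx⟩ := hin d hd hd' a ha hPa
    refine ⟨?_, fun y hy => ?_⟩
    · rintro _ ⟨y, -, rfl⟩
      exact stepMap_le hbc y
    · exact stepMap_of_pos (b := b) (c := c) hPx ▸ hy ⟨x, hx, rfl⟩
  · have hd₀ : ∀ x ∈ d, ¬ P x := fun x hx h => hPa (hup x a (ha.1 hx) h)
    have : stepMap P b c '' d = {b} := by
      rw [image_congr fun x hx => stepMap_of_neg (hd₀ x hx), hd.image_const]
    rw [this, stepMap_of_neg hPa]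
    exact isLUB_singleton

theorem scottContinuous_stepMap_compact [PartialOrder α] [PartialOrder β] {p : α}
    (hp : IsCompactElement p) (hbc : b ≤ c) : ScottContinuous (stepMap (p ≤ ·) b c) :=
  scottContinuous_stepMap (fun _ _ h h' => h'.trans h)
    (fun _ hd hd' _ ha h => hp _ _ hd hd' ha h) hbc

/-- A principal filter is closed under all existing meets: `p` is below the meet exactly when it is
below every element of `A`. The same argument gives preservation of meets in the stable and the
strongly stable case. -/
theorem isGLB_stepMap_image [PartialOrder α] [PartialOrder β] {p : α} (hbc : b ≤ c)
    {A : Set α} (hA : A.Nonempty) {m : α} (hm : IsGLB A m) :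
    IsGLB (stepMap (p ≤ ·) b c '' A) (stepMap (p ≤ ·) b c m) := by
  by_cases h : p ≤ m
  · have hA' : ∀ x ∈ A, p ≤ x := fun x hx => h.trans (hm.1 hx)
    rw [image_congr fun x hx => stepMap_of_pos (P := (p ≤ ·)) (hA' x hx), hA.image_const,
      stepMap_of_pos (P := (p ≤ ·)) h]
    exact isGLB_singleton
  · rw [stepMap_of_neg (P := (p ≤ ·)) h]
    obtain ⟨x, hx, hpx⟩ : ∃ x ∈ A, ¬ p ≤ x := by
      by_contra! hall
      exact h (hm.2 hall)
    refine ⟨?_, fun y hy => ?_⟩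
    · rintro _ ⟨y, -, rfl⟩
      rcases stepMap_eq_or (P := (p ≤ ·)) (b := b) (c := c) y with h | h <;> rw [h]
      exact hbc
    · exact stepMap_of_neg (P := (p ≤ ·)) (b := b) (c := c) hpx ▸ hy ⟨x, hx, rfl⟩

theorem isStable_stepMap [PartialOrder α] [PartialOrder β] {p : α} (hp : IsCompactElement p)
    (hbc : b ≤ c) : IsStable (stepMap (p ≤ ·) b c) where
  scottContinuous := scottContinuous_stepMap_compact hp hbc
  map_isGLB x y m _ hm := by
    have := isGLB_stepMap_image (p := p) hbc (insert_nonempty x {y}) hm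
    rwa [image_pair] at this

/-- Coherence of images needs nothing from the coherence of `A` beyond finiteness and non-emptiness:
all values are at most `c`, so the image lies below `{c}` in the Egli-Milner sense. -/
theorem isStronglyStable_stepMap {α : Type u} {β : Type v} {b c : β} [CoherentDIDomain α]
    [CoherentDIDomain β] {p : α} (hp : IsCompactElement p) (hbc : b ≤ c) :
    IsStronglyStable (stepMap (p ≤ ·) b c) where
  scottContinuous := scottContinuous_stepMap_compact hp hbc
  map_coh A hA := by
    have hne := (CoherentDIDomain.nonempty_of_coh A hA).image (stepMap (p ≤ ·) b c)
    refine CoherentDIDomain.coh_of_egliMilner _ (CoherentDIDomain.singleton_coh c) _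
      ((CoherentDIDomain.finite_of_coh A hA).image _) hne ?_ ?_
    · rintro _ ⟨x, -, rfl⟩
      exact ⟨c, rfl, stepMap_le hbc x⟩
    · rintro _ rfl
      obtain ⟨_, x, hx, rfl⟩ := hne
      exact ⟨_, ⟨x, hx, rfl⟩, stepMap_le hbc x⟩
  map_isGLB A hA _ hm := isGLB_stepMap_image hbc (CoherentDIDomain.nonempty_of_coh A hA) hm

end stepMap

/-! ## Continuous, stable and strongly stable models -/

theorem sSup_empty_le {α : Type u} [CompletePartialOrder α] (x : α) : sSup ∅ ≤ x :=
  (DirectedOn.isLUB_sSup (d := (∅ : Set α)) (by simp [DirectedOn])).2 (by simp)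

/-- By algebraicity an element all of whose compact approximations are bottom is itself bottom. -/
theorem DIDomain.exists_compact_not_le {α : Type u} [DIDomain α] [Nontrivial α] :
    ∃ p : α, IsCompactElement p ∧ ¬ p ≤ sSup ∅ := by
  obtain ⟨x, hx⟩ := exists_ne (sSup ∅ : α)
  by_contra! h
  exact hx (le_antisymm (DIDomain.le_of_compact fun c hc _ => h c hc) (sSup_empty_le x))

/-- Without algebraicity there may be no non-bottom compact element, so the step is taken on the
complement of bottom, which is Scott open in every cpo. -/
theorem ContinuousModel.directlyIndecomposable (D : ContinuousModel.{u}) :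
    D.toCombinatoryAlgebra.DirectlyIndecomposable := by
  refine CombinatoryAlgebra.directlyIndecomposable_of_twoValued _ (sSup ∅ : D.U) ?_
  intro (_ : Nontrivial D.U)
  obtain ⟨q, hq⟩ := exists_ne (sSup ∅ : D.U)
  refine ⟨q, fun (c : D.U) => ?_⟩
  have hs : ScottContinuous (stepMap (· ≠ (sSup ∅ : D.U)) (sSup ∅) c) := by
    refine scottContinuous_stepMap (fun x y hxy hx hy => ?_) (fun d hd _ a ha hPa => ?_)
      (sSup_empty_le c)
    · exact hx (le_antisymm (hy ▸ hxy) (sSup_empty_le x))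
    · by_contra! h
      exact hPa (le_antisymm (ha.2 fun x hx => (h x hx).le) (sSup_empty_le a))
  refine ⟨D.Abs ⟨_, hs⟩, ?_, ?_, fun x => ?_⟩ <;>
    simp only [ContinuousModel.toCombinatoryAlgebra, D.app_abs]
  · exact stepMap_of_neg (by simp)
  · exact stepMap_of_pos hq
  · exact stepMap_eq_or (P := (· ≠ (sSup ∅ : D.U))) x

/-- Two compatible non-bottom elements may meet in bottom, so the complement of bottom need not give
a stable map; the filter above a compact element does. -/
theorem StableModel.directlyIndecomposable (D : StableModel.{u}) :
    D.toCombinatoryAlgebra.DirectlyIndecomposable := by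
  refine CombinatoryAlgebra.directlyIndecomposable_of_twoValued _ (sSup ∅ : D.U) ?_
  intro (_ : Nontrivial D.U)
  obtain ⟨p, hp, hp'⟩ := DIDomain.exists_compact_not_le (α := D.U)
  refine ⟨p, fun (c : D.U) => ?_⟩
  refine ⟨D.Abs ⟨_, isStable_stepMap hp (sSup_empty_le c)⟩, ?_, ?_, fun x => ?_⟩ <;>
    simp only [StableModel.toCombinatoryAlgebra, D.app_abs]
  · exact stepMap_of_neg (P := (p ≤ ·)) hp'
  · exact stepMap_of_pos (P := (p ≤ ·)) le_rfl
  · exact stepMap_eq_or (P := (p ≤ ·)) x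

theorem StronglyStableModel.directlyIndecomposable (D : StronglyStableModel.{u}) :
    D.toCombinatoryAlgebra.DirectlyIndecomposable := by
  refine CombinatoryAlgebra.directlyIndecomposable_of_twoValued _ (sSup ∅ : D.U) ?_
  intro (_ : Nontrivial D.U)
  obtain ⟨p, hp, hp'⟩ := DIDomain.exists_compact_not_le (α := D.U)
  refine ⟨p, fun (c : D.U) => ?_⟩
  refine ⟨D.Abs ⟨_, isStronglyStable_stepMap hp (sSup_empty_le c)⟩, ?_, ?_, fun x => ?_⟩ <;>
    simp only [StronglyStableModel.toCombinatoryAlgebra, D.app_abs]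
  · exact stepMap_of_neg (P := (p ≤ ·)) hp'
  · exact stepMap_of_pos (P := (p ≤ ·)) le_rfl
  · exact stepMap_eq_or (P := (p ≤ ·)) x

/-! ## Substitution -/

namespace LambdaTerm

theorem rename_rename : ∀ (M : LambdaTerm) (ρ ρ' τ : ℕ → ℕ), (∀ n, ρ' (ρ n) = τ n) →
    rename ρ' (rename ρ M) = rename τ M := by
  intro M
  induction M with
  | var n =>
    intro ρ ρ' τ h
    simp only [rename, h]
  | app M N ihM ihN =>
    intro ρ ρ' τ h
    simp only [rename, ihM ρ ρ' τ h, ihN ρ ρ' τ h]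
  | lam M ih =>
    intro ρ ρ' τ h
    simp only [rename]
    rw [ih (liftRen ρ) (liftRen ρ') (liftRen τ)]
    rintro (_ | n)
    · rfl
    · simp only [liftRen, h n]

theorem rename_subst : ∀ (M : LambdaTerm) (ρ : ℕ → ℕ) (σ τ : ℕ → LambdaTerm),
    (∀ n, rename ρ (σ n) = τ n) → rename ρ (subst σ M) = subst τ M := by
  intro M
  induction M with
  | var n =>
    intro ρ σ τ h
    exact h n
  | app M N ihM ihN =>
    intro ρ σ τ h
    simp only [rename, subst, ihM ρ σ τ h, ihN ρ σ τ h]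
  | lam M ih =>
    intro ρ σ τ h
    simp only [rename, subst]
    rw [ih (liftRen ρ) (liftSub σ) (liftSub τ)]
    rintro (_ | n)
    · rfl
    · simp only [liftSub]
      rw [← h n, rename_rename (σ n) Nat.succ _ (fun m => (ρ m).succ) fun _ => rfl,
        rename_rename (σ n) ρ Nat.succ (fun m => (ρ m).succ) fun _ => rfl]

theorem subst_subst : ∀ (M : LambdaTerm) (σ σ' τ : ℕ → LambdaTerm),
    (∀ n, subst σ' (σ n) = τ n) → subst σ' (subst σ M) = subst τ M := by
  intro M
  induction M with
  | var n =>
    intro σ σ' τ h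
    exact h n
  | app M N ihM ihN =>
    intro σ σ' τ h
    simp only [subst, ihM σ σ' τ h, ihN σ σ' τ h]
  | lam M ih =>
    intro σ σ' τ h
    simp only [subst]
    rw [ih (liftSub σ) (liftSub σ') (liftSub τ)]
    rintro (_ | n)
    · rfl
    · simp only [liftSub]
      rw [← h n, subst_rename _ _ _ (fun m => rename Nat.succ (σ' m)) fun _ => rfl,
        rename_subst _ _ _ (fun m => rename Nat.succ (σ' m)) fun _ => rfl]

/-- Extend a substitution by a value for the variable `0`. -/
def consSub (N : LambdaTerm) (σ : ℕ → LambdaTerm) : ℕ → LambdaTerm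
  | 0 => N
  | n + 1 => σ n

/-- Contracting a redex whose body has been substituted into amounts to one simultaneous
substitution. Both closure under substitution and the abstraction case of realizability rest on this
form. -/
theorem inst_subst_liftSub (M N : LambdaTerm) (σ : ℕ → LambdaTerm) :
    inst (subst (liftSub σ) M) N = subst (consSub N σ) M := by
  refine subst_subst _ _ _ _ ?_
  rintro (_ | n)
  · rfl
  · exact inst_rename_succ (σ n) N

theorem subst_inst (M N : LambdaTerm) (σ : ℕ → LambdaTerm) :
    subst σ (inst M N) = inst (subst (liftSub σ) M) (subst σ N) := by
  rw [inst_subst_liftSub]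
  refine subst_subst _ _ _ _ ?_
  rintro (_ | n) <;> rfl

theorem subst_apps (σ : ℕ → LambdaTerm) (M : LambdaTerm) (Ms : List LambdaTerm) :
    subst σ (apps M Ms) = apps (subst σ M) (Ms.map (subst σ)) := by
  induction Ms generalizing M with
  | nil => rfl
  | cons N Ms ih => exact ih (app M N)

theorem BetaEq.subst {M N : LambdaTerm} (h : BetaEq M N) (σ : ℕ → LambdaTerm) :
    BetaEq (M.subst σ) (N.subst σ) := by
  induction h generalizing σ with
  | beta M N =>
    rw [subst_inst]
    exact .beta _ _
  | refl => exact .refl _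
  | symm _ ih => exact .symm (ih σ)
  | trans _ _ ih₁ ih₂ => exact .trans (ih₁ σ) (ih₂ σ)
  | app _ _ ih₁ ih₂ => exact .app (ih₁ σ) (ih₂ σ)
  | lam _ ih => exact .lam (ih _)

/-- A strict upper bound of the free variables. -/
def bound : LambdaTerm → ℕ
  | var n => n + 1
  | app M N => max (bound M) (bound N)
  | lam M => bound M - 1

theorem subst_congr : ∀ (M : LambdaTerm) (σ τ : ℕ → LambdaTerm), (∀ n < bound M, σ n = τ n) →
    subst σ M = subst τ M := by
  intro M
  induction M with
  | var n =>
    intro σ τ h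
    exact h n (Nat.lt_succ_self n)
  | app M N ihM ihN =>
    intro σ τ h
    simp only [bound, lt_max_iff] at h
    simp only [subst, ihM σ τ fun n hn => h n (.inl hn), ihN σ τ fun n hn => h n (.inr hn)]
  | lam M ih =>
    intro σ τ h
    simp only [subst]
    rw [ih (liftSub σ) (liftSub τ)]
    rintro (_ | n) hn
    · rfl
    · simp only [liftSub]
      rw [h n]
      simp only [bound]
      omega

end LambdaTerm

/-! ### Closure of `λ`-theories under substitution -/

namespace LambdaTheory

open LambdaTerm

theorem rel_of_betaEq (T : LambdaTheory) {M N : LambdaTerm} (h : BetaEq M N) : T.rel M N := by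
  induction h with
  | beta M N => exact T.beta M N
  | refl => exact T.equivalence.refl _
  | symm _ ih => exact T.equivalence.symm ih
  | trans _ _ ih₁ ih₂ => exact T.equivalence.trans ih₁ ih₂
  | app _ _ ih₁ ih₂ => exact T.app_congr ih₁ ih₂
  | lam _ ih => exact T.lam_congr ih

/-- Closure under substitution is not an axiom of a theory; it is simulated by β-redexes.
Abstracting the variable `0` leaves terms with a smaller bound, to which the shifted substitution `i
↦ σ (i + 1)` applies by induction, and applying the result to `σ 0` restores the last variable. At
bound `0` the terms are closed and substitution does nothing. -/
theorem rel_subst_of_bound (T : LambdaTheory) (n : ℕ) : ∀ {M N : LambdaTerm}, bound M ≤ n →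
    bound N ≤ n → T.rel M N → ∀ σ, T.rel (subst σ M) (subst σ N) := by
  induction n with
  | zero =>
    intro M N hM hN h σ
    rw [subst_congr M σ var (by omega), subst_congr N σ var (by omega),
      subst_var M var fun _ => rfl, subst_var N var fun _ => rfl]
    exact h
  | succ n ih =>
    intro M N hM hN h σ
    have h' := T.app_congr (ih (M := lam M) (N := lam N) (by simp only [bound]; omega)
      (by simp only [bound]; omega) (T.lam_congr h) fun i => σ (i + 1))
      (T.equivalence.refl (σ 0))
    have hβ : ∀ P, T.rel (app (subst (fun i => σ (i + 1)) (lam P)) (σ 0)) (subst σ P) := by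
      intro P
      have := T.beta (subst (liftSub fun i => σ (i + 1)) P) (σ 0)
      rw [inst_subst_liftSub, show consSub (σ 0) (fun i => σ (i + 1)) = σ by
        funext i; cases i <;> rfl] at this
      exact this
    exact T.equivalence.trans (T.equivalence.symm (hβ M)) (T.equivalence.trans h' (hβ N))

theorem rel_subst (T : LambdaTheory) {M N : LambdaTerm} (h : T.rel M N) (σ : ℕ → LambdaTerm) :
    T.rel (subst σ M) (subst σ N) :=
  T.rel_subst_of_bound (max (bound M) (bound N)) (le_max_left _ _) (le_max_right _ _) h σ

end LambdaTheory

/-! ## Intersection types -/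

/-- Intersection types: `arrow [A₁, …, Aₙ] B` is `A₁ ∧ ⋯ ∧ Aₙ → B`. -/
inductive InterType : Type
  | atom : InterType
  | arrow : List InterType → InterType → InterType

namespace LambdaTerm

open InterType

/-- Extend an environment by a value for the variable `0`. -/
def consEnv (X : Set InterType) (ρ : ℕ → Set InterType) : ℕ → Set InterType
  | 0 => X
  | n + 1 => ρ n

/-- The set of the types of a term in an environment. -/
def types : LambdaTerm → (ℕ → Set InterType) → Set InterType
  | var n, ρ => ρ n
  | app M N, ρ => {t | ∃ A : List InterType, (∀ a ∈ A, a ∈ types N ρ) ∧ arrow A t ∈ types M ρ}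
  | lam M, ρ => {t | ∃ A b, t = arrow A b ∧ b ∈ types M (consEnv {a | a ∈ A} ρ)}

theorem types_mono : ∀ (M : LambdaTerm) {ρ ρ' : ℕ → Set InterType}, (∀ n, ρ n ⊆ ρ' n) →
    types M ρ ⊆ types M ρ' := by
  intro M
  induction M with
  | var n =>
    intro ρ ρ' h
    exact h n
  | app M N ihM ihN =>
    rintro ρ ρ' h t ⟨A, hA, ht⟩
    exact ⟨A, fun a ha => ihN h (hA a ha), ihM h ht⟩
  | lam M ih =>
    rintro ρ ρ' h t ⟨A, b, rfl, hb⟩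
    refine ⟨A, b, rfl, ih ?_ hb⟩
    rintro (_ | n)
    · exact subset_rfl
    · exact h n

/-- A typing uses finitely many of the types of each variable. -/
theorem exists_list_of_mem_types : ∀ (M : LambdaTerm) {ρ : ℕ → Set InterType} {t : InterType},
    t ∈ types M ρ → ∃ L : ℕ → List InterType, (∀ n, ∀ a ∈ L n, a ∈ ρ n) ∧
      t ∈ types M fun n => {a | a ∈ L n} := by
  intro M
  induction M with
  | var n =>
    intro ρ t ht
    refine ⟨fun m => if m = n then [t] else [], fun m a ha => ?_, ?_⟩
    · dsimp only at ha
      split_ifs at ha with h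
      · subst h
        obtain rfl := List.mem_singleton.1 ha
        exact ht
      · exact absurd ha List.not_mem_nil
    · simp [types]
  | app M N ihM ihN =>
    rintro ρ t ⟨A, hA, ht⟩
    obtain ⟨L, hL, htL⟩ := ihM ht
    -- Each of the finitely many types of the argument comes with its own finite environment; these
    -- are merged by concatenation, which monotonicity allows.
    have hN : ∀ A : List InterType, (∀ a ∈ A, a ∈ types N ρ) → ∃ L : ℕ → List InterType,
        (∀ n, ∀ a ∈ L n, a ∈ ρ n) ∧ ∀ a ∈ A, a ∈ types N fun n => {a | a ∈ L n} := by
      intro A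
      induction A with
      | nil => exact fun _ => ⟨fun _ => [], by simp, by simp⟩
      | cons a A ih =>
        intro h
        obtain ⟨L₁, hL₁, h₁⟩ := ihN (h a (by simp))
        obtain ⟨L₂, hL₂, h₂⟩ := ih fun a ha => h a (by simp [ha])
        refine ⟨fun n => L₁ n ++ L₂ n, fun n b hb => ?_, fun b hb => ?_⟩
        · rcases List.mem_append.1 hb with hb | hb
          · exact hL₁ n b hb
          · exact hL₂ n b hb
        · rcases List.mem_cons.1 hb with rfl | hb
          · exact types_mono N (fun n c (hc : c ∈ L₁ n) => List.mem_append_left _ hc) h₁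
          · exact types_mono N (fun n c (hc : c ∈ L₂ n) => List.mem_append_right _ hc) (h₂ b hb)
    obtain ⟨L', hL', hA'⟩ := hN A hA
    refine ⟨fun n => L n ++ L' n, fun n b hb => ?_, A, fun a ha => ?_, ?_⟩
    · rcases List.mem_append.1 hb with hb | hb
      · exact hL n b hb
      · exact hL' n b hb
    · exact types_mono N (fun n c (hc : c ∈ L' n) => List.mem_append_right _ hc) (hA' a ha)
    · exact types_mono M (fun n c (hc : c ∈ L n) => List.mem_append_left _ hc) htL
  | lam M ih =>
    rintro ρ t ⟨A, b, rfl, hb⟩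
    obtain ⟨L, hL, hbL⟩ := ih hb
    refine ⟨fun n => L (n + 1), fun n => hL (n + 1), A, b, rfl, types_mono M ?_ hbL⟩
    rintro (_ | n)
    · exact hL 0
    · exact subset_rfl

theorem types_rename : ∀ (M : LambdaTerm) (r : ℕ → ℕ) (ρ ρ' : ℕ → Set InterType),
    (∀ n, ρ (r n) = ρ' n) → types (rename r M) ρ = types M ρ' := by
  intro M
  induction M with
  | var n =>
    intro r ρ ρ' h
    exact h n
  | app M N ihM ihN =>
    intro r ρ ρ' h
    simp only [rename, types, ihM r ρ ρ' h, ihN r ρ ρ' h]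
  | lam M ih =>
    intro r ρ ρ' h
    simp only [rename, types]
    have : ∀ X, types (rename (liftRen r) M) (consEnv X ρ) = types M (consEnv X ρ') := by
      intro X
      refine ih _ _ _ ?_
      rintro (_ | n)
      · rfl
      · exact h n
    simp only [this]

theorem types_subst : ∀ (M : LambdaTerm) (σ : ℕ → LambdaTerm) (ρ ρ' : ℕ → Set InterType),
    (∀ n, types (σ n) ρ = ρ' n) → types (subst σ M) ρ = types M ρ' := by
  intro M
  induction M with
  | var n =>
    intro σ ρ ρ' h
    exact h n
  | app M N ihM ihN =>
    intro σ ρ ρ' h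
    simp only [subst, types, ihM σ ρ ρ' h, ihN σ ρ ρ' h]
  | lam M ih =>
    intro σ ρ ρ' h
    simp only [subst, types]
    have : ∀ X, types (subst (liftSub σ) M) (consEnv X ρ) = types M (consEnv X ρ') := by
      intro X
      refine ih _ _ _ ?_
      rintro (_ | n)
      · rfl
      · exact (types_rename _ _ _ _ fun _ => rfl).trans (h n)
    simp only [this]

/-- Both sides are the types of `M` with `types N ρ` as the value of the bound variable. Contraction
needs only monotonicity; expansion needs that a typing uses finitely many types, since the source of
an arrow is a finite list. -/
theorem types_beta (M N : LambdaTerm) (ρ : ℕ → Set InterType) :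
    types (app (lam M) N) ρ = types (inst M N) ρ := by
  have hs : types (inst M N) ρ = types M (consEnv (types N ρ) ρ) := by
    refine types_subst M _ _ _ ?_
    rintro (_ | n) <;> rfl
  rw [hs]
  ext t
  constructor
  · rintro ⟨A, hA, A', b, he, hb⟩
    obtain ⟨rfl, rfl⟩ := InterType.arrow.inj he
    refine types_mono M ?_ hb
    rintro (_ | n)
    · exact hA
    · exact subset_rfl
  · intro ht
    obtain ⟨L, hL, htL⟩ := exists_list_of_mem_types M ht
    refine ⟨L 0, hL 0, L 0, t, rfl, types_mono M ?_ htL⟩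
    rintro (_ | n)
    · exact subset_rfl
    · exact hL (n + 1)

/-- The types of a term are invariant under `β`-conversion. -/
theorem BetaEq.types_eq {M N : LambdaTerm} (h : BetaEq M N) (ρ : ℕ → Set InterType) :
    types M ρ = types N ρ := by
  induction h generalizing ρ with
  | beta M N => exact types_beta M N ρ
  | refl => rfl
  | symm _ ih => exact (ih ρ).symm
  | trans _ _ ih₁ ih₂ => exact (ih₁ ρ).trans (ih₂ ρ)
  | app _ _ ih₁ ih₂ => simp only [LambdaTerm.types, ih₁ ρ, ih₂ ρ]
  | lam _ ih => simp only [LambdaTerm.types, ih]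

/-- With the type `[] → ⋯ → [] → t` at the head, the arguments need no type at all; this is why a
head normal form is typable whatever its arguments are. -/
theorem mem_types_apps {ρ : ℕ → Set InterType} {t : InterType} (Ms : List LambdaTerm)
    {M : LambdaTerm} (h : Ms.foldr (fun _ s => arrow [] s) t ∈ types M ρ) :
    t ∈ types (apps M Ms) ρ := by
  induction Ms generalizing M with
  | nil => exact h
  | cons N Ms ih => exact ih (M := app M N) ⟨[], by simp, h⟩

/-- A solvable term is typable. -/
theorem Solvable.exists_mem_types {M : LambdaTerm} (h : Solvable M) :
    ∃ t, t ∈ types M fun _ => univ := by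
  obtain ⟨n, i, Ms, h⟩ := h
  rw [h.types_eq]
  clear h
  induction n with
  | zero => exact ⟨atom, mem_types_apps Ms (mem_univ _)⟩
  | succ n ih =>
    obtain ⟨t, ht⟩ := ih
    obtain ⟨L, -, htL⟩ := exists_list_of_mem_types _ ht
    refine ⟨arrow (L 0) t, L 0, t, rfl, types_mono _ ?_ htL⟩
    rintro (_ | n)
    · exact subset_rfl
    · exact subset_univ _

/-- The term `(λx.xx)(λx.xx)`. -/
def omega : LambdaTerm := app (lam (app (var 0) (var 0))) (lam (app (var 0) (var 0)))

/-- Infinite descent. If `λx.xx` has the type `A → t` and all types in `A`, then typing `xx` from `x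
: A` yields `A' → t ∈ A` with `A' ⊆ A`. So `A'` is again such a source, and it is strictly smaller
because `A' → t` is a member of `A`. -/
theorem types_omega (ρ : ℕ → Set InterType) : types omega ρ = ∅ := by
  have key : ∀ (n : ℕ) (A : List InterType) (t : InterType), sizeOf A ≤ n →
      (∀ a ∈ A, a ∈ types (lam (app (var 0) (var 0))) ρ) →
      arrow A t ∉ types (lam (app (var 0) (var 0))) ρ := by
    intro n
    induction n with
    | zero =>
      intro A t hn
      cases A <;> simp at hn
    | succ n ih =>
      rintro A t hn hA ⟨A₀, t₀, he, A', hA', hm⟩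
      obtain ⟨rfl, rfl⟩ := InterType.arrow.inj he
      have hlt := List.sizeOf_lt_of_mem (show arrow A' t ∈ A from hm)
      simp only [InterType.arrow.sizeOf_spec] at hlt
      exact ih A' t (by omega) (fun a ha => hA a (hA' a ha)) (hA _ hm)
  refine eq_empty_of_forall_notMem ?_
  rintro t ⟨A, hA, ht⟩
  exact key _ A t le_rfl hA ht

/-! ## Realizability -/

/-- The terms convertible to a term whose head is the variable `0` or `1`. -/
def HeadZeroOne : Set LambdaTerm :=
  {M | ∃ i Ms, i < 2 ∧ BetaEq M (apps (var i) Ms)}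

/-- The realizers of an intersection type. -/
def realizers : InterType → Set LambdaTerm
  | atom => HeadZeroOne
  | arrow A b => {M | ∀ N, (∀ a, a ∈ A → N ∈ realizers a) → app M N ∈ realizers b}

theorem mem_realizers_arrow {A : List InterType} {b : InterType} {M : LambdaTerm} :
    M ∈ realizers (arrow A b) ↔
      ∀ N, (∀ a ∈ A, N ∈ realizers a) → app M N ∈ realizers b := by
  rw [realizers]
  rfl

theorem realizers_betaEq : ∀ (t : InterType) {M N : LambdaTerm}, BetaEq M N →
    N ∈ realizers t → M ∈ realizers t
  | atom, M, N, h, hN => by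
    rw [realizers] at hN ⊢
    obtain ⟨i, Ms, hi, hMs⟩ := hN
    exact ⟨i, Ms, hi, h.trans hMs⟩
  | arrow A b, M, N, h, hN => by
    rw [mem_realizers_arrow] at hN ⊢
    exact fun P hP => realizers_betaEq b (h.app (.refl P)) (hN P hP)

/-- A term headed by a variable keeps its head when applied. Hence the variables `0` and `1` realize
every type, and may be assigned all types at once. -/
theorem headZeroOne_subset_realizers : ∀ t : InterType, HeadZeroOne ⊆ realizers t
  | atom => by rw [realizers]
  | arrow A b => by
    rintro M ⟨i, Ms, hi, hMs⟩
    rw [mem_realizers_arrow]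
    refine fun N _ => headZeroOne_subset_realizers b ⟨i, Ms ++ [N], hi, ?_⟩
    simpa [apps] using hMs.app (.refl N)

/-- The variable `0` is an admissible argument for every arrow, so feeding it in repeatedly descends
to the atom; `k` is the number of arrows on the way. -/
theorem exists_headZeroOne_of_mem_realizers : ∀ (t : InterType) {M : LambdaTerm},
    M ∈ realizers t → ∃ k, apps M (List.replicate k (var 0)) ∈ HeadZeroOne
  | atom, M, h => by
    rw [realizers] at h
    exact ⟨0, h⟩
  | arrow A b, M, h => by
    rw [mem_realizers_arrow] at h
    obtain ⟨k, hk⟩ := exists_headZeroOne_of_mem_realizers b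
      (h (var 0) fun a _ => headZeroOne_subset_realizers a ⟨0, [], by omega, .refl _⟩)
    exact ⟨k + 1, hk⟩

/-- Soundness of typing for the realizability interpretation. The abstraction case works because the
sets of realizers are closed under β-conversion. -/
theorem subst_mem_realizers : ∀ (M : LambdaTerm) {ρ : ℕ → Set InterType}
    {σ : ℕ → LambdaTerm} {t : InterType}, (∀ n, ∀ a ∈ ρ n, σ n ∈ realizers a) →
    t ∈ types M ρ → subst σ M ∈ realizers t := by
  intro M
  induction M with
  | var n =>
    intro ρ σ t h ht
    exact h n t ht
  | app M N ihM ihN =>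
    rintro ρ σ t h ⟨A, hA, ht⟩
    exact mem_realizers_arrow.1 (ihM h ht) _ fun a ha => ihN h (hA a ha)
  | lam M ih =>
    rintro ρ σ _ h ⟨A, t, rfl, ht⟩
    refine mem_realizers_arrow.2 fun N hN => ?_
    have hβ := BetaEq.beta (subst (liftSub σ) M) N
    rw [inst_subst_liftSub] at hβ
    refine realizers_betaEq t hβ (ih ?_ ht)
    rintro (_ | n)
    · exact hN
    · exact h n

end LambdaTerm

/-! ## Term models -/

namespace CombinatoryAlgebra

/-- The element `k(k(⋯(ka)))`, which takes `n` arguments and returns `a`. -/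
def constFun (A : CombinatoryAlgebra.{u}) (a : A.carrier) : ℕ → A.carrier
  | 0 => a
  | n + 1 => A.app A.k (A.constFun a n)

theorem foldl_constFun (A : CombinatoryAlgebra.{u}) (a : A.carrier) (xs : List A.carrier) :
    xs.foldl A.app (A.constFun a xs.length) = a := by
  induction xs with
  | nil => rfl
  | cons x xs ih =>
    simp only [List.length_cons, List.foldl_cons, constFun, A.k_app]
    exact ih

theorem foldl_constFun_replicate (A : CombinatoryAlgebra.{u}) (a x : A.carrier) (n : ℕ) :
    (List.replicate n x).foldl A.app (A.constFun a n) = a := by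
  have := A.foldl_constFun a (List.replicate n x)
  rwa [List.length_replicate] at this

theorem map_foldl {A : CombinatoryAlgebra.{u}} {B : CombinatoryAlgebra.{v}}
    (f : A.carrier → B.carrier) (hf : ∀ x y, f (A.app x y) = B.app (f x) (f y))
    (g : A.carrier) (xs : List A.carrier) :
    f (xs.foldl A.app g) = (xs.map f).foldl B.app (f g) := by
  induction xs generalizing g with
  | nil => rfl
  | cons x xs ih => rw [List.foldl_cons, ih, hf, List.map_cons, List.foldl_cons]

/-- If every `e` with `exx = x` has one of its first two arguments at the head of `exyx⋯x`, then
the algebra is directly indecomposable. -/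
theorem directlyIndecomposable_of_head (A : CombinatoryAlgebra.{u})
    (h : ∀ e, (∀ x, A.app (A.app e x) x = x) → ∃ k m : ℕ,
      (∀ x y, ∃ zs : List A.carrier, zs.length = m ∧
        (List.replicate k x).foldl A.app (A.app (A.app e x) y) = zs.foldl A.app x) ∨
      (∀ x y, ∃ zs : List A.carrier, zs.length = m ∧
        (List.replicate k x).foldl A.app (A.app (A.app e x) y) = zs.foldl A.app y)) :
    A.DirectlyIndecomposable := by
  rintro ⟨B, C, hB, hC, ⟨φ⟩⟩
  obtain ⟨ψ, hψ⟩ : ∃ ψ : A.carrier ≃ B.carrier × C.carrier, ∀ x y,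
      ψ (A.app x y) = (B.app (ψ x).1 (ψ y).1, C.app (ψ x).2 (ψ y).2) :=
    ⟨φ.toEquiv, φ.map_app⟩
  -- First projection in `B`, second projection in `C`, where `skk` acts as the identity.
  let e := ψ.symm (B.k, C.app C.k (C.app (C.app C.s C.k) C.k))
  have he : ∀ x y, ψ (A.app (A.app e x) y) = ((ψ x).1, (ψ y).2) := by
    intro x y
    simp only [e, hψ, Equiv.apply_symm_apply, B.k_app, C.k_app, C.s_app]
  have h₁ : ∀ (g : A.carrier) (xs : List A.carrier), (ψ (xs.foldl A.app g)).1 =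
      (xs.map fun x => (ψ x).1).foldl B.app (ψ g).1 :=
    map_foldl (fun x => (ψ x).1) fun x y => by rw [hψ]
  have h₂ : ∀ (g : A.carrier) (xs : List A.carrier), (ψ (xs.foldl A.app g)).2 =
      (xs.map fun x => (ψ x).2).foldl C.app (ψ g).2 :=
    map_foldl (fun x => (ψ x).2) fun x y => by rw [hψ]
  obtain ⟨k, m, h | h⟩ := h e fun x => ψ.injective (he x x)
  -- Head `x`: let `x` swallow the `m` arguments and return `A.k`, an arbitrary fixed element. The
  -- second coordinate of `exy` is that of `y`, which is made to swallow the `k` copies of `x` and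
  -- return some `c` other than the second coordinate of `A.k`. The bound `m` must not depend on
  -- `x`, since `x` is built from it.
  · obtain ⟨c, hc⟩ := exists_ne (ψ A.k).2
    obtain ⟨zs, rfl, hzs⟩ := h (A.constFun A.k m) (ψ.symm (B.k, C.constFun c k))
    rw [A.foldl_constFun] at hzs
    have := congrArg (fun x => (ψ x).2) hzs
    simp only [h₂, he, List.map_replicate, Equiv.apply_symm_apply,
      C.foldl_constFun_replicate] at this
    exact hc this
  -- Head `y`: the same with the roles of the arguments and of the coordinates exchanged.
  · obtain ⟨b, hb⟩ := exists_ne (ψ A.k).1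
    obtain ⟨zs, rfl, hzs⟩ := h (ψ.symm (B.constFun b k, C.k)) (A.constFun A.k m)
    rw [A.foldl_constFun] at hzs
    have := congrArg (fun x => (ψ x).1) hzs
    simp only [h₁, he, List.map_replicate, Equiv.apply_symm_apply,
      B.foldl_constFun_replicate] at this
    exact hb this

end CombinatoryAlgebra

/-! ### Idempotent binary operations in semi-sensible theories -/

namespace LambdaTheory

open LambdaTerm

/-- In a semi-sensible theory, an idempotent binary operation `exy` has `x` or `y` at the head of
`exyx⋯x`. -/
theorem SemiSensible.exists_head {T : LambdaTheory} (hT : T.SemiSensible) {e : LambdaTerm}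
    (he : ∀ N, T.rel (app (app e N) N) N) :
    ∃ k m : ℕ,
      (∀ X Y, ∃ Ms : List LambdaTerm, Ms.length = m ∧
        BetaEq (apps (app (app e X) Y) (List.replicate k X)) (apps X Ms)) ∨
      (∀ X Y, ∃ Ms : List LambdaTerm, Ms.length = m ∧
        BetaEq (apps (app (app e X) Y) (List.replicate k X)) (apps Y Ms)) := by
  -- Replacing the free variables of `e` by Ω prevents them from serving as the head.
  let e₀ := subst (fun _ => omega) e
  have he₀ : T.rel (app (app e₀ (var 0)) (var 0)) (var 0) := by
    -- Idempotence is used at the variable `bound e`, which is fresh for `e`, so that it survives as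
    -- `var 0` while everything in `e` is replaced.
    have h := T.rel_subst (he (var (bound e))) fun n => if n = bound e then var 0 else omega
    simp only [subst, if_true] at h
    rwa [subst_congr e _ (fun _ => omega) fun n hn => if_neg hn.ne] at h
  obtain ⟨t, ht⟩ := (hT _ _ (T.equivalence.symm he₀) ⟨0, 0, [], .refl _⟩).exists_mem_types
  -- The shift frees the indices `0` and `1` for the two arguments.
  let e₂ := rename (· + 2) e
  let ρ : ℕ → Set InterType := fun n => if n < 2 then univ else ∅
  have ht' : t ∈ types (app (app e₂ (var 0)) (var 1)) ρ := by
    -- Ω has no types, so substituting it has the same effect as giving the free variables of `e`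
    -- the empty set of types.
    have h₀ : types e₀ (fun _ => univ) = types e₂ ρ := by
      rw [types_subst e _ _ (fun _ => ∅) fun n => types_omega _,
        types_rename e _ ρ (fun _ => ∅) fun n => if_neg (by omega)]
    have h₁ : ρ 0 = univ := if_pos (by omega)
    have h₂ : ρ 1 = univ := if_pos (by omega)
    -- An application sees its argument only through its types; as both variables have all types,
    -- the second occurrence of `0` may be replaced by `1`.
    simp only [types, h₀] at ht
    simpa only [types, h₁, h₂] using ht
  -- The identity substitution is admissible: `0` and `1` realize every type, and the other
  -- variables have no type to realize.
  have hr := subst_mem_realizers _ (σ := var) (fun n a ha => ?_) ht'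
  swap
  · refine headZeroOne_subset_realizers a ⟨n, [], ?_, .refl _⟩
    by_contra hn
    simp only [ρ, if_neg hn, mem_empty_iff_false] at ha
  rw [subst_var _ var fun _ => rfl] at hr
  obtain ⟨k, i, Ms, hi, hk⟩ := exists_headZeroOne_of_mem_realizers t hr
  -- Conversion is preserved by substituting `X` and `Y` for `0` and `1` and undoing the shift. The
  -- number of arguments after the head, `Ms.length`, is the same for all `X` and `Y`.
  have key : ∀ X Y, BetaEq (apps (app (app e X) Y) (List.replicate k X))
      (apps (consSub X (consSub Y var) i) (Ms.map (subst (consSub X (consSub Y var))))) := by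
    intro X Y
    have h := hk.subst (consSub X (consSub Y var))
    simp only [subst_apps, subst, List.map_replicate, e₂,
      subst_rename e (· + 2) (consSub X (consSub Y var)) var fun _ => rfl,
      subst_var e var fun _ => rfl] at h
    exact h
  refine ⟨k, Ms.length, ?_⟩
  obtain rfl | rfl : i = 0 ∨ i = 1 := by omega
  · exact .inl fun X Y => ⟨_, List.length_map _, key X Y⟩
  · exact .inr fun X Y => ⟨_, List.length_map _, key X Y⟩

theorem mk_apps (T : LambdaTheory) (M : LambdaTerm) (Ms : List LambdaTerm) :
    (Quotient.mk T.setoid (apps M Ms) : T.termModel.carrier) =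
      (Ms.map (Quotient.mk T.setoid)).foldl T.termModel.app (Quotient.mk T.setoid M) := by
  induction Ms generalizing M with
  | nil => rfl
  | cons N Ms ih => exact ih (app M N)

theorem SemiSensible.directlyIndecomposable {T : LambdaTheory} (hT : T.SemiSensible) :
    T.termModel.DirectlyIndecomposable := by
  refine CombinatoryAlgebra.directlyIndecomposable_of_head _ fun e he => ?_
  induction e using Quotient.inductionOn with | _ e
  obtain ⟨k, m, h⟩ := hT.exists_head fun N =>
    Quotient.exact (s := T.setoid) (he (Quotient.mk T.setoid N))
  have key : ∀ (X Y Z : LambdaTerm) (Ms : List LambdaTerm),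
      BetaEq (apps (app (app e X) Y) (List.replicate k X)) (apps Z Ms) →
      (List.replicate k (Quotient.mk T.setoid X)).foldl T.termModel.app
        (T.termModel.app (T.termModel.app (Quotient.mk T.setoid e) (Quotient.mk T.setoid X))
          (Quotient.mk T.setoid Y)) =
      (Ms.map (Quotient.mk T.setoid)).foldl T.termModel.app (Quotient.mk T.setoid Z) := by
    intro X Y Z Ms hβ
    have := Quotient.sound (s := T.setoid) (T.rel_of_betaEq hβ)
    rw [mk_apps, mk_apps, List.map_replicate] at this
    exact this
  refine ⟨k, m, h.imp (fun h x y => ?_) fun h x y => ?_⟩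
  all_goals
    induction x using Quotient.inductionOn with | _ X
    induction y using Quotient.inductionOn with | _ Y
    obtain ⟨Ms, hl, hβ⟩ := h X Y
    exact ⟨Ms.map (Quotient.mk T.setoid), (List.length_map _).trans hl, key _ _ _ _ hβ⟩

end LambdaTheory

theorem mainTheorem7 :
    (∀ D : ContinuousModel.{u}, D.toCombinatoryAlgebra.DirectlyIndecomposable) ∧
    (∀ D : StableModel.{u}, D.toCombinatoryAlgebra.DirectlyIndecomposable) ∧
    (∀ D : StronglyStableModel.{u}, D.toCombinatoryAlgebra.DirectlyIndecomposable) ∧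
    (∀ T : LambdaTheory, T.SemiSensible → T.termModel.DirectlyIndecomposable) :=
  ⟨ContinuousModel.directlyIndecomposable, StableModel.directlyIndecomposable,
    StronglyStableModel.directlyIndecomposable, fun _ hT => hT.directlyIndecomposable⟩
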